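/- **Setting.** Let $H,m,d\ge 1$ and let $\sigma:\mathbb R\to\mathbb R$ be twice continuously differentiable with $\|\sigma\|_\infty\le\sigma_0$, $\|\sigma'\|_\infty\le\sigma_1$, $\|\sigma''\|_\infty\le\sigma_2$. For $W^{(1)}\in\mathbb R^{m\times d}$, $W^{(2)},\dots,W^{(H)}\in\mathbb R^{m\times m}$, $c\in\mathbb R^m$ and $w=\mathrm{vec}(W^{(1)},\dots,W^{(H)},c)\in\mathbb R^p$ put $x^{(0)}=x$, $x^{(h)}=\frac1{\sqrt m}\sigma(W^{(h)}x^{(h-1)})$ (with $\sigma$ applied entrywise) and $\varphi(x;w)=c^\top x^{(H)}$. Let $\mathcal X\subset\mathbb R^d$ and $\mathcal Y\subset\mathbb R$ with $\|x\|_2\le1$ on $\mathcal X$ and $|y|\le 1$ on $\mathcal Y$, and $\mathcal Z=\mathcal X\times\mathcal Y$. Let $\nu>0$ and let $\ell:\mathbb R\times\mathcal Z\to\mathbb R$ be such that, for each $z\in\mathcal Z$, $\ell(\cdot,z)$ is twice differentiable and $\nu$-strongly convex. Let $\mathcal C\subset\mathbb R^p$ be compact and convex, $w_0\in\mathcal C$,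 and let $r_{\mathcal C},\mathrm{Lip}_\ell,\mathrm{Lip}_{\ell'},\mathrm{Lip}_\varphi,\mathrm{Lip}_{\nabla\varphi}$ be real numbers with - $\operatorname{diam}\mathcal C\le r_{\mathcal C}$; - $\|\nabla_w\varphi(x;w)\|_2\le\mathrm{Lip}_\varphi$ and $\|\nabla_w^2\varphi(x;w)\|_2\le\mathrm{Lip}_{\nabla\varphi}$ for all $w\in\mathcal C$, $\|x\|_2\le1$; - $|\partial_t\ell(t,z)|\le\mathrm{Lip}_\ell$ and $|\partial_t^2\ell(t,z)|\le\mathrm{Lip}_{\ell'}$ for all $z\in\mathcal Z$, $t\in[-R,R]$, where $R=\sup\{|\varphi(x;w)|: w\in\mathcal C,\|x\|_2\le1\}$. **Algorithm.** Let $1\le B\le n$ and let $I_0,I_1,\dots$ be i.i.d., uniform over the $B$-element subsets of $\{1,\dots,n\}$. For a training set $s=(z_1,\dots,z_n)\in\mathcal Z^n$, $z_j=(x_j,y_j)$, let $J_t(w)=[\nabla_w^\top\varphi(x_j;w)]_{j\in I_t}$, $G_t(w)=[\partial_t\ell(\varphi(x_j;w),z_j)]_{j\in I_t}$, $\Psi_t(w)=J_t(w)^\top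 G_t(w)$ and, for $\lambda,\alpha,\eta>0$, $$\mathbf H_t=\alpha\sum_{i=0}^t J_i(w_i)^\top J_i(w_i)+\lambda\mathbf I,\qquad w_{t+1}=\operatorname*{arg\,min}_{v\in\mathcal C}\big\|v-\big(w_t-\eta\mathbf H_t^{-1}\Psi_t(w_t)\big)\big\|_{\mathbf H_t}^2,$$ where $\|v\|_{\mathbf M}=\sqrt{v^\top \mathbf Mv}$. Let $s,s'\in\mathcal Z^n$ differ in exactly one coordinate, let $(w_t,\mathbf H_t)$ and $(w_t',\mathbf H_t')$ be the runs on $s$ and $s'$ with the same $w_0$ and the same $(I_t)$, and put $\Delta_t=w_t-w_t'$, $\bar{\mathbf H}_t=\frac12(\mathbf H_t+\mathbf H_t')$. Assume that for some $\mu_0>0$ the full Jacobian $J(w)=[\nabla_w^\top\varphi(x_j;w)]_{j\le n}$ of $s$ satisfies $J(w)J(w)^\top\succeq\mu_0^2\mathbf I$ for all $w\in\mathcal C$. **Corollary 2 (Worst-case stability).** Let $\varepsilon=B\,\mathrm{Lip}_\ell\mathrm{Lip}_{\nabla\varphi}$, $\Lambda=B\,\mathrm{Lip}_\varphi^2+\varepsilon$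 and $M=\max\{2/\nu,\,8(\Lambda+\varepsilon)/(\nu^2\mu_0^2)\}$. There is a constant $K>0$ depending only on $r_{\mathcal C},\mathrm{Lip}_\ell,\mathrm{Lip}_{\ell'},\mathrm{Lip}_\varphi,\nu,\mu_0$ such that for all $k\ge1$, $\lambda>0$ and $\xi\in[M,\,k\lambda/(2\Lambda)]$, with $\alpha=\frac1{Bk}$ and $\eta=\xi\alpha$, $$\mathbb E\|\Delta_k\|_{\bar{\mathbf H}_{k-1}}\le K\Big(\sqrt{B\xi k\,\mathrm{Lip}_{\nabla\varphi}}+\sqrt k\,B\,\mathrm{Lip}_{\nabla\varphi}+\frac{Bk}{\sqrt\lambda}\Big(\mathrm{Lip}_{\nabla\varphi}+\frac1n\Big)+\frac{B\xi}{n\sqrt\lambda}\Big).$$ -/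

import Mathlib

open MeasureTheory ProbabilityTheory
open scoped Matrix Gradient

noncomputable section

namespace SGN

/-! ### Deep feedforward networks -/

/-- Index set of the scalar parameters of a network of depth `H ≥ 1`, width `m`, input dimension
`d`: entries of `W⁽¹⁾ ∈ ℝ^{m×d}`, of `W⁽²⁾, …, W⁽ᴴ⁾ ∈ ℝ^{m×m}`, and of the output layer
`c ∈ ℝ^m`. -/
abbrev ParamIdx (d m H : ℕ) : Type :=
  (Fin m × Fin d) ⊕ (Fin (H - 1) × Fin m × Fin m) ⊕ Fin m

/-- The parameter space `ℝ^p` with the Euclidean norm. -/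
abbrev Param (d m H : ℕ) : Type := EuclideanSpace ℝ (ParamIdx d m H)

/-- A sample `z = (x, y)`. -/
abbrev Sample (d : ℕ) : Type := EuclideanSpace ℝ (Fin d) × ℝ

/-- The first weight matrix `W⁽¹⁾`. -/
def inWeight {d m H : ℕ} (w : Param d m H) : Matrix (Fin m) (Fin d) ℝ :=
  Matrix.of fun i j => w (Sum.inl (i, j))

/-- The weight matrices `W⁽ʰ⁺²⁾`, `h = 0, …, H - 2`. -/
def hidWeight {d m H : ℕ} (w : Param d m H) (h : Fin (H - 1)) : Matrix (Fin m) (Fin m) ℝ :=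
  Matrix.of fun i j => w (Sum.inr (Sum.inl (h, i, j)))

/-- The output weights `c`. -/
def outWeight {d m H : ℕ} (w : Param d m H) : Fin m → ℝ :=
  fun i => w (Sum.inr (Sum.inr i))

/-- One layer `v ↦ m^{-1/2} σ(W v)`. -/
def layer {κ : Type} [Fintype κ] {m : ℕ} (σ : ℝ → ℝ) (W : Matrix (Fin m) κ ℝ) (v : κ → ℝ) :
    Fin m → ℝ :=
  fun i => (1 / √(m : ℝ)) * σ ((W *ᵥ v) i)

/-- Composition of `L` further layers of width `m`, with weights `W 0`, then `W 1`, and so on. -/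
def hidden {m : ℕ} (σ : ℝ → ℝ) :
    (L : ℕ) → (Fin L → Matrix (Fin m) (Fin m) ℝ) → (Fin m → ℝ) → Fin m → ℝ
  | 0, _, v => v
  | L + 1, W, v => layer σ (W (Fin.last L)) (hidden σ L (fun h => W h.castSucc) v)

/-- The network `φ(x; w) = cᵀ x⁽ᴴ⁾(W)`. -/
def predictor {d m H : ℕ} (σ : ℝ → ℝ) (x : EuclideanSpace ℝ (Fin d)) (w : Param d m H) : ℝ :=
  outWeight w ⬝ᵥ hidden σ (H - 1) (hidWeight w) (layer σ (inWeight w) x.ofLp)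

/-- A smooth activation with `‖σ‖_∞ ≤ σ₀`, `‖σ'‖_∞ ≤ σ₁`, `‖σ''‖_∞ ≤ σ₂`. -/
structure IsActivation (σ : ℝ → ℝ) (σ₀ σ₁ σ₂ : ℝ) : Prop where
  contDiff : ContDiff ℝ 2 σ
  bound : ∀ t, |σ t| ≤ σ₀
  bound_deriv : ∀ t, |deriv σ t| ≤ σ₁
  bound_deriv_two : ∀ t, |deriv (deriv σ) t| ≤ σ₂

/-! ### Constants of the problem -/

/-- For every sample in `𝒵` the loss is twice differentiable and `ν`-strongly convex in the
prediction. -/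
structure IsLoss {d : ℕ} (l : ℝ → Sample d → ℝ) (𝒵 : Set (Sample d)) (ν : ℝ) : Prop where
  differentiable : ∀ z ∈ 𝒵, Differentiable ℝ (fun t => l t z)
  differentiable_deriv : ∀ z ∈ 𝒵, Differentiable ℝ (deriv fun t => l t z)
  strongConvex : ∀ z ∈ 𝒵, StrongConvexOn Set.univ ν (fun t => l t z)

/-- The compact interval `K = [-R, R]`, `R = sup {|φ(x; w)| : w ∈ C, ‖x‖ ≤ 1}`. -/
def predInterval {d m H : ℕ} (σ : ℝ → ℝ) (C : Set (Param d m H)) : Set ℝ :=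
  let R : ℝ := sSup {a | ∃ w ∈ C, ∃ x : EuclideanSpace ℝ (Fin d), ‖x‖ ≤ 1 ∧ a = |predictor σ x w|}
  Set.Icc (-R) R

/-- `L` is a Lipschitz constant on `K` of the losses `l(·, z)`, `z ∈ 𝒵`. -/
def LossLip {d m H : ℕ} (l : ℝ → Sample d → ℝ) (𝒵 : Set (Sample d)) (σ : ℝ → ℝ)
    (C : Set (Param d m H)) (L : ℝ) : Prop :=
  ∀ z ∈ 𝒵, ∀ t ∈ predInterval σ C, |deriv (fun t => l t z) t| ≤ L

/-- `L` is a smoothness constant on `K` of the losses `l(·, z)`, `z ∈ 𝒵`. -/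
def LossSmooth {d m H : ℕ} (l : ℝ → Sample d → ℝ) (𝒵 : Set (Sample d)) (σ : ℝ → ℝ)
    (C : Set (Param d m H)) (L : ℝ) : Prop :=
  ∀ z ∈ 𝒵, ∀ t ∈ predInterval σ C, |deriv (deriv fun t => l t z) t| ≤ L

/-- `L ≥ sup ‖∇_w φ(x; w)‖` over `w ∈ C`, `‖x‖ ≤ 1`. -/
def PredLip {d m H : ℕ} (σ : ℝ → ℝ) (C : Set (Param d m H)) (L : ℝ) : Prop :=
  ∀ w ∈ C, ∀ x : EuclideanSpace ℝ (Fin d), ‖x‖ ≤ 1 → ‖∇ (predictor σ x) w‖ ≤ L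

/-- `L ≥ sup ‖∇²_w φ(x; w)‖` (spectral norm) over `w ∈ C`, `‖x‖ ≤ 1`. -/
def PredGradLip {d m H : ℕ} (σ : ℝ → ℝ) (C : Set (Param d m H)) (L : ℝ) : Prop :=
  ∀ w ∈ C, ∀ x : EuclideanSpace ℝ (Fin d), ‖x‖ ≤ 1 →
    ‖fderiv ℝ (∇ (predictor σ x)) w‖ ≤ L

/-! ### Stochastic Gauss–Newton -/

/-- The Jacobian `[∇ᵀ φ(x_j; w)]_j` on a family of samples. -/
def jacobian {d m H : ℕ} {κ : Type} (σ : ℝ → ℝ) (s : κ → Sample d) (w : Param d m H) :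
    Matrix κ (ParamIdx d m H) ℝ :=
  Matrix.of fun j i => (∇ (predictor σ (s j).1) w) i

/-- The vector `[l'(φ(x_j; w); z_j)]_j` on a family of samples. -/
def lossGrad {d m H : ℕ} {κ : Type} (σ : ℝ → ℝ) (l : ℝ → Sample d → ℝ) (s : κ → Sample d)
    (w : Param d m H) : κ → ℝ :=
  fun j => deriv (fun t => l t (s j)) (predictor σ (s j).1 w)

/-- The minibatch of the training set `s` with index set `I`. -/
def batch {d n : ℕ} (s : Fin n → Sample d) (I : Finset (Fin n)) : I → Sample d :=
  fun j => s j

/-- The minibatch gradient `Ψ(w) = J(w)ᵀ G(w)`. -/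
def batchGrad {d m H n : ℕ} (σ : ℝ → ℝ) (l : ℝ → Sample d → ℝ) (s : Fin n → Sample d)
    (I : Finset (Fin n)) (w : Param d m H) : ParamIdx d m H → ℝ :=
  (jacobian σ (batch s I) w)ᵀ *ᵥ lossGrad σ l (batch s I) w

/-- `J(w)ᵀ J(w)` on a minibatch. -/
def batchGram {d m H n : ℕ} (σ : ℝ → ℝ) (s : Fin n → Sample d) (I : Finset (Fin n))
    (w : Param d m H) : Matrix (ParamIdx d m H) (ParamIdx d m H) ℝ :=
  (jacobian σ (batch s I) w)ᵀ * jacobian σ (batch s I) w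

/-- `‖v‖_M = √(vᵀ M v)`. -/
def wnorm {ι : Type} [Fintype ι] (M : Matrix ι ι ℝ) (v : EuclideanSpace ℝ ι) : ℝ :=
  √(v.ofLp ⬝ᵥ (M *ᵥ v.ofLp))

/-- `π_C^M(u) = argmin_{v ∈ C} ‖v - u‖_M²`. The minimizer exists and is unique if `C` is nonempty,
closed and convex and `M` is positive definite. -/
def proj {ι : Type} [Fintype ι] (M : Matrix ι ι ℝ) (C : Set (EuclideanSpace ℝ ι))
    (u : EuclideanSpace ℝ ι) : EuclideanSpace ℝ ι :=
  Classical.epsilon fun v => v ∈ C ∧ ∀ v' ∈ C, wnorm M (v - u) ^ 2 ≤ wnorm M (v' - u) ^ 2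

/-- The pair `(w_t, H_{t-1})`, with `H_{-1} = λ 𝟙`, for the minibatch index sets `I 0, I 1, …`. -/
def state {d m H n : ℕ} (σ : ℝ → ℝ) (l : ℝ → Sample d → ℝ) (C : Set (Param d m H))
    (w₀ : Param d m H) (lam α η : ℝ) (s : Fin n → Sample d) (I : ℕ → Finset (Fin n)) :
    ℕ → Param d m H × Matrix (ParamIdx d m H) (ParamIdx d m H) ℝ
  | 0 => (w₀, lam • (1 : Matrix (ParamIdx d m H) (ParamIdx d m H) ℝ))
  | t + 1 =>
    let w := (state σ l C w₀ lam α η s I t).1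
    let M := (state σ l C w₀ lam α η s I t).2 + α • batchGram σ s (I t) w
    (proj M C (w - η • WithLp.toLp 2 (M⁻¹ *ᵥ batchGrad σ l s (I t) w)), M)

/-- The iterate `w_t`. -/
def iter {d m H n : ℕ} (σ : ℝ → ℝ) (l : ℝ → Sample d → ℝ) (C : Set (Param d m H))
    (w₀ : Param d m H) (lam α η : ℝ) (s : Fin n → Sample d) (I : ℕ → Finset (Fin n)) (t : ℕ) :
    Param d m H :=
  (state σ l C w₀ lam α η s I t).1

/-- The preconditioner `H_t`. -/
def precond {d m H n : ℕ} (σ : ℝ → ℝ) (l : ℝ → Sample d → ℝ) (C : Set (Param d m H))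
    (w₀ : Param d m H) (lam α η : ℝ) (s : Fin n → Sample d) (I : ℕ → Finset (Fin n)) (t : ℕ) :
    Matrix (ParamIdx d m H) (ParamIdx d m H) ℝ :=
  (state σ l C w₀ lam α η s I (t + 1)).2

theorem iter_succ {d m H n : ℕ} (σ : ℝ → ℝ) (l : ℝ → Sample d → ℝ) (C : Set (Param d m H))
    (w₀ : Param d m H) (lam α η : ℝ) (s : Fin n → Sample d) (I : ℕ → Finset (Fin n)) (t : ℕ) :
    iter σ l C w₀ lam α η s I (t + 1) =
      proj (precond σ l C w₀ lam α η s I t) C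
        (iter σ l C w₀ lam α η s I t - η • WithLp.toLp 2
          ((precond σ l C w₀ lam α η s I t)⁻¹ *ᵥ
            batchGrad σ l s (I t) (iter σ l C w₀ lam α η s I t))) := rfl

theorem precond_eq {d m H n : ℕ} (σ : ℝ → ℝ) (l : ℝ → Sample d → ℝ) (C : Set (Param d m H))
    (w₀ : Param d m H) (lam α η : ℝ) (s : Fin n → Sample d) (I : ℕ → Finset (Fin n)) (t : ℕ) :
    precond σ l C w₀ lam α η s I t =
      α • ∑ i ∈ Finset.range (t + 1), batchGram σ s (I i) (iter σ l C w₀ lam α η s I i)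
        + lam • (1 : Matrix (ParamIdx d m H) (ParamIdx d m H) ℝ) := by
  induction t with
  | zero =>
    simp only [precond, iter, state, zero_add, Finset.sum_range_one]
    exact add_comm _ _
  | succ t ih =>
    rw [Finset.sum_range_succ, smul_add, add_right_comm, ← ih]
    rfl

/-- The minibatch index sets are independent and uniformly distributed over the subsets of
`{1, …, n}` with `B` elements. -/
structure IsSubsampling {Ω : Type*} [MeasurableSpace Ω] {n : ℕ} (P : Measure Ω) (B : ℕ)
    (I : ℕ → Ω → Finset (Fin n)) : Prop where
  measurableSet : ∀ t M, MeasurableSet {ω | I t ω = M}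
  law : ∀ t M, M.card = B → P {ω | I t ω = M} = ((n.choose B : ℕ) : ENNReal)⁻¹
  indep : iIndepFun (m := fun _ => (⊤ : MeasurableSpace (Finset (Fin n)))) I P

/-- `‖Δ_k‖_{H̄_{k-1}}`, `Δ_k = w_k - w'_k`, `H̄_{k-1} = (H_{k-1} + H'_{k-1}) / 2`, for `k ≥ 1`,
where the two runs have training sets `s`, `s'` and share the initial point and the minibatch index
sets. -/
def deviation {d m H n : ℕ} (σ : ℝ → ℝ) (l : ℝ → Sample d → ℝ) (C : Set (Param d m H))
    (w₀ : Param d m H) (lam α η : ℝ) (s s' : Fin n → Sample d) (I : ℕ → Finset (Fin n)) (k : ℕ) :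
    ℝ :=
  wnorm ((1 / 2 : ℝ) • (precond σ l C w₀ lam α η s I (k - 1)
      + precond σ l C w₀ lam α η s' I (k - 1)))
    (iter σ l C w₀ lam α η s I k - iter σ l C w₀ lam α η s' I k)

end SGN

end

namespace SGN

/-! ### Bilinear forms of matrices -/

section Form

variable {ι : Type} [Fintype ι]

/-- The bilinear form `(u, v) ↦ uᵀ M v` on Euclidean space. -/
noncomputable def form (M : Matrix ι ι ℝ) : LinearMap.BilinForm ℝ (EuclideanSpace ℝ ι) :=
  LinearMap.mk₂ ℝ (fun u v => u.ofLp ⬝ᵥ (M *ᵥ v.ofLp))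
    (fun _ _ _ => by simp [add_dotProduct])
    (fun _ _ _ => by simp [smul_dotProduct])
    (fun _ _ _ => by simp [Matrix.mulVec_add, dotProduct_add])
    (fun _ _ _ => by simp [Matrix.mulVec_smul, dotProduct_smul])

theorem form_apply (M : Matrix ι ι ℝ) (u v : EuclideanSpace ℝ ι) :
    form M u v = u.ofLp ⬝ᵥ (M *ᵥ v.ofLp) := rfl

theorem form_add_matrix (M N : Matrix ι ι ℝ) (u v : EuclideanSpace ℝ ι) :
    form (M + N) u v = form M u v + form N u v := by
  simp [form_apply, Matrix.add_mulVec, dotProduct_add]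

theorem form_smul_matrix (c : ℝ) (M : Matrix ι ι ℝ) (u v : EuclideanSpace ℝ ι) :
    form (c • M) u v = c * form M u v := by
  simp [form_apply, Matrix.smul_mulVec, dotProduct_smul]

theorem dotProduct_ofLp (u v : EuclideanSpace ℝ ι) : u.ofLp ⬝ᵥ v.ofLp = inner ℝ u v := by
  simp [EuclideanSpace.inner_eq_star_dotProduct, dotProduct_comm]

theorem form_one [DecidableEq ι] (u v : EuclideanSpace ℝ ι) :
    form (1 : Matrix ι ι ℝ) u v = inner ℝ u v := by
  simp [form_apply, dotProduct_ofLp]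

theorem wnorm_eq_sqrt (M : Matrix ι ι ℝ) (v : EuclideanSpace ℝ ι) :
    wnorm M v = √(form M v v) := rfl

theorem form_inv_mulVec [DecidableEq ι] {M : Matrix ι ι ℝ} {lam : ℝ} (hlam : 0 < lam)
    (hM : ∀ v, lam * ‖v‖ ^ 2 ≤ form M v v) (u p : EuclideanSpace ℝ ι) :
    form M u (WithLp.toLp 2 (M⁻¹ *ᵥ p.ofLp)) = inner ℝ u p := by
  have hu : IsUnit M := by
    rw [← Matrix.mulVec_injective_iff_isUnit, ← Matrix.coe_mulVecLin, ← LinearMap.ker_eq_bot,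
      LinearMap.ker_eq_bot']
    intro x hx
    have h := hM (WithLp.toLp 2 x)
    rw [form_apply] at h
    rw [Matrix.mulVecLin_apply] at hx
    simp only [hx, dotProduct_zero] at h
    have h0 : ‖WithLp.toLp 2 x‖ ^ 2 ≤ 0 := by
      by_contra hc
      push Not at hc
      nlinarith
    have h1 : WithLp.toLp 2 x = 0 := by
      rw [← norm_eq_zero]
      exact pow_eq_zero_iff two_ne_zero |>.1 (le_antisymm h0 (sq_nonneg _))
    simpa using congrArg WithLp.ofLp h1
  have hd : IsUnit M.det := (Matrix.isUnit_iff_isUnit_det M).1 hu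
  rw [form_apply, Matrix.mulVec_mulVec, Matrix.mul_nonsing_inv M hd, Matrix.one_mulVec,
    dotProduct_ofLp]

theorem form_le_sqrt_mul_sqrt {M : Matrix ι ι ℝ} (hs : ∀ u v, form M u v = form M v u)
    (hp : ∀ v, 0 ≤ form M v v) (u v : EuclideanSpace ℝ ι) :
    form M u v ≤ √(form M u u) * √(form M v v) := by
  rw [← Real.sqrt_mul (hp u)]
  apply Real.le_sqrt_of_sq_le
  have := LinearMap.BilinForm.apply_mul_apply_le_of_forall_zero_le (form M) hp u v
  rw [hs v u] at this
  rw [sq]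
  exact this

/-! ### Projections in the norm of a matrix -/

theorem proj_spec {M : Matrix ι ι ℝ} {C : Set (EuclideanSpace ℝ ι)} (hC : IsCompact C)
    (hne : C.Nonempty) (u : EuclideanSpace ℝ ι) :
    proj M C u ∈ C ∧ ∀ v' ∈ C, wnorm M (proj M C u - u) ^ 2 ≤ wnorm M (v' - u) ^ 2 := by
  have hcont : Continuous fun v : EuclideanSpace ℝ ι => wnorm M (v - u) ^ 2 := by
    unfold wnorm dotProduct Matrix.mulVec dotProduct
    fun_prop
  obtain ⟨v, hv, hmin⟩ := hC.exists_isMinOn hne hcont.continuousOn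
  exact Classical.epsilon_spec
    (p := fun v => v ∈ C ∧ ∀ v' ∈ C, wnorm M (v - u) ^ 2 ≤ wnorm M (v' - u) ^ 2)
    ⟨v, hv, fun v' hv' => hmin hv'⟩

theorem proj_variational {M : Matrix ι ι ℝ} (hs : ∀ u v, form M u v = form M v u)
    (hp : ∀ v, 0 ≤ form M v v) {C : Set (EuclideanSpace ℝ ι)} (hC : IsCompact C)
    (hconv : Convex ℝ C) (u : EuclideanSpace ℝ ι) {v' : EuclideanSpace ℝ ι} (hv' : v' ∈ C) :
    0 ≤ form M (proj M C u - u) (v' - proj M C u) := by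
  obtain ⟨hmem, hmin⟩ := proj_spec (M := M) hC ⟨v', hv'⟩ u
  set v := proj M C u
  set b := form M (v - u) (v' - v) with hb
  set c := form M (v' - v) (v' - v) with hc
  have key : ∀ θ : ℝ, 0 < θ → θ ≤ 1 → 0 ≤ 2 * b + θ * c := by
    intro θ h0 h1
    have h := hmin (v + θ • (v' - v)) (hconv.add_smul_sub_mem hmem hv' ⟨h0.le, h1⟩)
    rw [wnorm_eq_sqrt, wnorm_eq_sqrt, Real.sq_sqrt (hp _), Real.sq_sqrt (hp _)] at h
    have e : v + θ • (v' - v) - u = (v - u) + θ • (v' - v) := by abel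
    have expand : ∀ x y : EuclideanSpace ℝ ι, form M (x + θ • y) (x + θ • y)
        = form M x x + 2 * θ * form M x y + θ ^ 2 * form M y y := by
      intro x y
      simp only [map_add, LinearMap.add_apply, map_smul, LinearMap.smul_apply, smul_eq_mul, hs y x]
      ring
    rw [e, expand, ← hb, ← hc] at h
    have : 0 ≤ θ * (2 * b + θ * c) := by linarith
    exact nonneg_of_mul_nonneg_right this h0
  by_contra hneg
  push Not at hneg
  have hc0 : 0 ≤ c := hp _
  have h := key (min 1 (-b / (c + 1))) (lt_min one_pos (div_pos (by linarith) (by linarith)))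
    (min_le_left _ _)
  have h2 : min 1 (-b / (c + 1)) * c ≤ -b := by
    have h3 : min 1 (-b / (c + 1)) * c ≤ -b / (c + 1) * c :=
      mul_le_mul_of_nonneg_right (min_le_right _ _) hc0
    have h4 : -b / (c + 1) * (c + 1) = -b := div_mul_cancel₀ _ (by linarith)
    have h5 : 0 ≤ -b / (c + 1) := div_nonneg (by linarith) (by linarith)
    nlinarith
  linarith

/-- One projected and preconditioned gradient step satisfies a variational inequality. -/
theorem proj_step_variational [DecidableEq ι] {M : Matrix ι ι ℝ}
    (hs : ∀ u v, form M u v = form M v u) {lam : ℝ} (hlam : 0 < lam)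
    (hM : ∀ v, lam * ‖v‖ ^ 2 ≤ form M v v) {C : Set (EuclideanSpace ℝ ι)} (hC : IsCompact C)
    (hconv : Convex ℝ C) (w p : EuclideanSpace ℝ ι) (η : ℝ) {v v' : EuclideanSpace ℝ ι}
    (hv : v = proj M C (w - η • WithLp.toLp 2 (M⁻¹ *ᵥ p.ofLp))) (hv' : v' ∈ C) :
    0 ≤ form M (v - w) (v' - v) + η * inner ℝ p (v' - v) := by
  have h := proj_variational hs (fun v => (by positivity : 0 ≤ lam * ‖v‖ ^ 2).trans (hM v)) hC
    hconv (w - η • WithLp.toLp 2 (M⁻¹ *ᵥ p.ofLp)) hv'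
  rw [← hv, ← sub_add, map_add, LinearMap.add_apply, map_smul, LinearMap.smul_apply,
    hs (WithLp.toLp 2 (M⁻¹ *ᵥ p.ofLp)), form_inv_mulVec hlam hM, real_inner_comm] at h
  exact h

/-- If `‖b‖² ≤ ⟨a - η M⁻¹ p, b⟩ + e |b|` in the geometry of `M`, then `‖b‖` is at most the norm of
`a - η M⁻¹ p` plus `e / √λ`. -/
theorem sqrt_form_le_of_form_le [DecidableEq ι] {M : Matrix ι ι ℝ}
    (hs : ∀ u v, form M u v = form M v u) {lam : ℝ} (hlam : 0 < lam)
    (hM : ∀ v, lam * ‖v‖ ^ 2 ≤ form M v v) (a b p : EuclideanSpace ℝ ι) {η e D : ℝ}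
    (he : 0 ≤ e) (hD : 0 ≤ D)
    (hb : form M b b ≤ form M a b - η * inner ℝ p b + e * ‖b‖)
    (ha : form M a a - 2 * η * inner ℝ p a + η ^ 2 * ‖p‖ ^ 2 / lam ≤ D ^ 2) :
    √(form M b b) ≤ D + e / √lam := by
  have hp : ∀ v, 0 ≤ form M v v := fun v => (by positivity : 0 ≤ lam * ‖v‖ ^ 2).trans (hM v)
  have hsl : 0 < √lam := Real.sqrt_pos.2 hlam
  set q : EuclideanSpace ℝ ι := WithLp.toLp 2 (M⁻¹ *ᵥ p.ofLp) with hq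
  have hq1 : ∀ u, form M u q = inner ℝ u p := fun u => form_inv_mulVec hlam hM u p
  have hq2 : form M q q ≤ ‖p‖ ^ 2 / lam := by
    have h1 : form M q q ≤ ‖q‖ * ‖p‖ := by rw [hq1]; exact real_inner_le_norm _ _
    have h2 := hM q
    rw [le_div_iff₀ hlam]
    have h3 : lam * ‖q‖ ≤ ‖p‖ := by
      by_contra hc
      push Not at hc
      have hq0 : 0 < ‖q‖ := by
        rcases (norm_nonneg q).eq_or_lt with h | h
        · rw [← h] at hc; simp at hc; linarith [norm_nonneg p]
        · exact h
      nlinarith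
    nlinarith [norm_nonneg q, norm_nonneg p]
  have h1 : form M (a - η • q) (a - η • q) ≤ D ^ 2 := by
    have : form M (a - η • q) (a - η • q)
        = form M a a - 2 * η * inner ℝ p a + η ^ 2 * form M q q := by
      simp only [map_sub, LinearMap.sub_apply, map_smul, LinearMap.smul_apply, smul_eq_mul]
      rw [hs q a, hq1 a, real_inner_comm]
      ring
    rw [this]
    have : η ^ 2 * form M q q ≤ η ^ 2 * ‖p‖ ^ 2 / lam := by
      rw [mul_div_assoc]; exact mul_le_mul_of_nonneg_left hq2 (sq_nonneg _)
    linarith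
  have h2 : form M (a - η • q) b ≤ D * √(form M b b) :=
    (form_le_sqrt_mul_sqrt hs hp _ _).trans
      (mul_le_mul_of_nonneg_right (Real.sqrt_le_iff.2 ⟨hD, h1⟩) (Real.sqrt_nonneg _))
  have h3 : form M (a - η • q) b = form M a b - η * inner ℝ p b := by
    simp only [map_sub, LinearMap.sub_apply, map_smul, LinearMap.smul_apply, smul_eq_mul]
    rw [hs q b, hq1 b, real_inner_comm]
  have h4 : ‖b‖ ≤ √(form M b b) / √lam := by
    rw [le_div_iff₀ hsl]
    apply Real.le_sqrt_of_sq_le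
    rw [mul_pow, Real.sq_sqrt hlam.le, mul_comm]
    exact hM b
  set y := √(form M b b) with hy
  have hy0 : 0 ≤ y := Real.sqrt_nonneg _
  have hyy : y ^ 2 = form M b b := Real.sq_sqrt (hp b)
  have h5 : e * ‖b‖ ≤ e / √lam * y := by
    calc e * ‖b‖ ≤ e * (y / √lam) := mul_le_mul_of_nonneg_left h4 he
      _ = e / √lam * y := by ring
  rcases hy0.eq_or_lt with h | h
  · rw [← h]; positivity
  · have : y * y ≤ (D + e / √lam) * y := by nlinarith
    exact le_of_mul_le_mul_right this h

end Form

end SGN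
namespace SGN

/-! ### Regularity of the network -/

section Network

variable {d m H : ℕ} {σ : ℝ → ℝ}

theorem contDiff_layer {E : Type*} [NormedAddCommGroup E] [NormedSpace ℝ E] {κ : Type} [Fintype κ]
    {k : WithTop ℕ∞} (hσ : ContDiff ℝ k σ) {W : E → Matrix (Fin m) κ ℝ}
    (hW : ∀ i j, ContDiff ℝ k fun w => W w i j) {v : E → κ → ℝ}
    (hv : ∀ j, ContDiff ℝ k fun w => v w j) (i : Fin m) :
    ContDiff ℝ k fun w => layer σ (W w) (v w) i := by
  unfold layer Matrix.mulVec dotProduct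
  exact contDiff_const.mul (hσ.comp (ContDiff.sum fun j _ => (hW i j).mul (hv j)))

theorem contDiff_hidden {E : Type*} [NormedAddCommGroup E] [NormedSpace ℝ E]
    {k : WithTop ℕ∞} (hσ : ContDiff ℝ k σ) (L : ℕ) {W : E → Fin L → Matrix (Fin m) (Fin m) ℝ}
    (hW : ∀ h i j, ContDiff ℝ k fun w => W w h i j) {v : E → Fin m → ℝ}
    (hv : ∀ j, ContDiff ℝ k fun w => v w j) (i : Fin m) :
    ContDiff ℝ k fun w => hidden σ L (W w) (v w) i := by
  induction L generalizing i with
  | zero => exact hv i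
  | succ L ih =>
    exact contDiff_layer hσ (fun i j => hW (Fin.last L) i j)
      (fun j => ih (fun h i j => hW h.castSucc i j) j) i

theorem contDiff_predictor {k : WithTop ℕ∞} (hσ : ContDiff ℝ k σ) (x : EuclideanSpace ℝ (Fin d)) :
    ContDiff ℝ k (predictor (m := m) (H := H) σ x) := by
  have hcoord : ∀ i : ParamIdx d m H, ContDiff ℝ k fun w : Param d m H => w i := fun i => by
    fun_prop
  unfold predictor dotProduct
  exact ContDiff.sum fun i _ => (hcoord _).mul
    (contDiff_hidden hσ (H - 1) (W := fun w => hidWeight w)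
      (fun h i j => hcoord (Sum.inr (Sum.inl (h, i, j))))
      (contDiff_layer hσ (W := fun w => inWeight w) (fun i j => hcoord (Sum.inl (i, j)))
        (v := fun _ => x.ofLp) (fun j => contDiff_const)) i)

theorem contDiff_gradient_predictor (hσ : ContDiff ℝ 2 σ) (x : EuclideanSpace ℝ (Fin d)) :
    ContDiff ℝ 1 (∇ (predictor (m := m) (H := H) σ x)) := by
  have h : ContDiff ℝ 1 (fderiv ℝ (predictor (m := m) (H := H) σ x)) :=
    (contDiff_predictor hσ x).fderiv_right (by norm_num)
  exact (InnerProductSpace.toDual ℝ (Param d m H)).symm.contDiff.comp h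

theorem abs_layer_le {κ : Type} [Fintype κ] {σ₀ : ℝ} (hσ : ∀ t, |σ t| ≤ σ₀)
    (W : Matrix (Fin m) κ ℝ) (v : κ → ℝ) (i : Fin m) :
    |layer σ W v i| ≤ 1 / √(m : ℝ) * σ₀ := by
  unfold layer
  rw [abs_mul, abs_of_nonneg (by positivity : 0 ≤ 1 / √(m : ℝ))]
  exact mul_le_mul_of_nonneg_left (hσ _) (by positivity)

theorem abs_hidden_le {σ₀ : ℝ} (hσ : ∀ t, |σ t| ≤ σ₀) (L : ℕ)
    (W : Fin L → Matrix (Fin m) (Fin m) ℝ) {v : Fin m → ℝ}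
    (hv : ∀ i, |v i| ≤ 1 / √(m : ℝ) * σ₀) (i : Fin m) :
    |hidden σ L W v i| ≤ 1 / √(m : ℝ) * σ₀ := by
  cases L with
  | zero => exact hv i
  | succ L => exact abs_layer_le hσ _ _ i

theorem abs_predictor_le {σ₀ : ℝ} (hσ : ∀ t, |σ t| ≤ σ₀) (x : EuclideanSpace ℝ (Fin d))
    (w : Param d m H) : |predictor σ x w| ≤ m * (‖w‖ * (1 / √(m : ℝ) * σ₀)) := by
  unfold predictor dotProduct
  refine (Finset.abs_sum_le_sum_abs _ _).trans ?_
  refine (Finset.sum_le_card_nsmul _ _ (‖w‖ * (1 / √(m : ℝ) * σ₀)) fun i _ => ?_).trans (by simp)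
  rw [abs_mul]
  exact mul_le_mul (PiLp.norm_apply_le w _)
    (abs_hidden_le hσ _ _ (fun i => abs_layer_le hσ _ _ i) i) (abs_nonneg _) (norm_nonneg _)

theorem predictor_mem_predInterval {σ₀ : ℝ} (hσ : ∀ t, |σ t| ≤ σ₀) {C : Set (Param d m H)}
    (hC : IsCompact C) {w : Param d m H} (hw : w ∈ C) {x : EuclideanSpace ℝ (Fin d)}
    (hx : ‖x‖ ≤ 1) : predictor σ x w ∈ predInterval σ C := by
  obtain ⟨R, hR⟩ := hC.isBounded.exists_norm_le
  have hσ0 : 0 ≤ σ₀ := (abs_nonneg _).trans (hσ 0)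
  rw [predInterval, Set.mem_Icc, ← abs_le]
  refine le_csSup ⟨m * (R * (1 / √(m : ℝ) * σ₀)), ?_⟩ ⟨w, hw, x, hx, rfl⟩
  rintro _ ⟨w', hw', x', -, rfl⟩
  refine (abs_predictor_le hσ x' w').trans ?_
  have := hR w' hw'
  gcongr

theorem differentiable_predictor (hσ : ContDiff ℝ 2 σ) (x : EuclideanSpace ℝ (Fin d)) :
    Differentiable ℝ (predictor (m := m) (H := H) σ x) :=
  (contDiff_predictor hσ x).differentiable (by norm_num)

theorem norm_gradient_sub_le (hσ : ContDiff ℝ 2 σ) {C : Set (Param d m H)} (hconv : Convex ℝ C)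
    {Lg : ℝ} (hLg : PredGradLip σ C Lg) {x : EuclideanSpace ℝ (Fin d)} (hx : ‖x‖ ≤ 1)
    {w w' : Param d m H} (hw : w ∈ C) (hw' : w' ∈ C) :
    ‖∇ (predictor σ x) w - ∇ (predictor σ x) w'‖ ≤ Lg * ‖w - w'‖ :=
  hconv.norm_image_sub_le_of_norm_fderiv_le
    (fun v _ => (contDiff_gradient_predictor hσ x).differentiable (by norm_num) v)
    (fun v hv => hLg v hv x hx) hw' hw

/-- First-order Taylor estimate along a segment, at either of its end points. -/
theorem abs_inner_gradient_sub_le (hσ : ContDiff ℝ 2 σ) {C : Set (Param d m H)}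
    (hconv : Convex ℝ C) {Lg : ℝ} (hLg : PredGradLip σ C Lg) (hLg0 : 0 ≤ Lg)
    {x : EuclideanSpace ℝ (Fin d)} (hx : ‖x‖ ≤ 1) {w w' a : Param d m H} (hw : w ∈ C)
    (hw' : w' ∈ C) (ha : a ∈ segment ℝ w' w) :
    |inner ℝ (∇ (predictor σ x) a) (w - w') - (predictor σ x w - predictor σ x w')|
      ≤ Lg * ‖w - w'‖ ^ 2 := by
  have hseg : segment ℝ w' w ⊆ C := hconv.segment_subset hw' hw
  have h := (convex_segment (𝕜 := ℝ) w' w).norm_image_sub_le_of_norm_fderiv_le'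
    (f := predictor σ x) (φ := fderiv ℝ (predictor σ x) a) (C := Lg * ‖w - w'‖)
    (fun v _ => differentiable_predictor hσ x v)
    (fun v hv => by
      rw [← toDual_gradient, ← toDual_gradient, ← map_sub, LinearIsometryEquiv.norm_map]
      refine (norm_gradient_sub_le hσ hconv hLg hx (hseg hv) (hseg ha)).trans ?_
      refine mul_le_mul_of_nonneg_left ?_ hLg0
      rw [segment_eq_image'] at hv ha
      obtain ⟨s, hs, rfl⟩ := hv
      obtain ⟨t, ht, rfl⟩ := ha
      rw [add_sub_add_left_eq_sub, ← sub_smul, norm_smul]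
      refine mul_le_of_le_one_left (norm_nonneg _) ?_
      rw [Real.norm_eq_abs, abs_le]
      constructor <;> linarith [hs.1, hs.2, ht.1, ht.2])
    (left_mem_segment ℝ w' w) (right_mem_segment ℝ w' w)
  rw [Real.norm_eq_abs, ← inner_gradient_left, abs_sub_comm] at h
  rwa [sq, ← mul_assoc]

end Network

/-! ### The loss -/

section Loss

variable {d m H : ℕ} {σ : ℝ → ℝ} {l : ℝ → Sample d → ℝ} {𝒵 : Set (Sample d)} {ν : ℝ}

theorem IsLoss.mul_sq_le (hl : IsLoss l 𝒵 ν) {z : Sample d} (hz : z ∈ 𝒵) (a b : ℝ) :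
    ν * (a - b) ^ 2 ≤ (deriv (fun t => l t z) a - deriv (fun t => l t z) b) * (a - b) := by
  have hd : Differentiable ℝ fun t => l t z := hl.differentiable z hz
  have hc := strongConvexOn_iff_convex.1 (hl.strongConvex z hz)
  have hderiv : ∀ t, HasDerivAt (fun t => l t z - ν / 2 * ‖t‖ ^ 2)
      (deriv (fun t => l t z) t - ν * t) t := by
    intro t
    have h2 : HasDerivAt (fun t : ℝ => ν / 2 * ‖t‖ ^ 2) (ν * t) t := by
      have h3 : (fun t : ℝ => ν / 2 * ‖t‖ ^ 2) = fun t => ν / 2 * t ^ 2 := by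
        funext t
        rw [Real.norm_eq_abs, sq_abs]
      have h4 : ν * t = ν / 2 * ((2 : ℕ) * t ^ (2 - 1)) := by push_cast; ring
      rw [h3, h4]
      exact (hasDerivAt_pow 2 t).const_mul (ν / 2)
    exact (hd t).hasDerivAt.sub h2
  have hmono := hc.monotoneOn_deriv fun t _ => (hderiv t).differentiableAt
  have key : ∀ a b, a ≤ b → deriv (fun t => l t z) a - ν * a ≤ deriv (fun t => l t z) b - ν * b := by
    intro a b hab
    have := hmono (Set.mem_univ a) (Set.mem_univ b) hab
    rwa [(hderiv a).deriv, (hderiv b).deriv] at this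
  rcases le_total a b with h | h
  · nlinarith [key a b h]
  · nlinarith [key b a h]

theorem IsLoss.abs_deriv_sub_le (hl : IsLoss l 𝒵 ν) {C : Set (Param d m H)} {L : ℝ}
    (hL : LossSmooth l 𝒵 σ C L) {z : Sample d} (hz : z ∈ 𝒵) {a b : ℝ}
    (ha : a ∈ predInterval σ C) (hb : b ∈ predInterval σ C) :
    |deriv (fun t => l t z) a - deriv (fun t => l t z) b| ≤ L * |a - b| :=
  (convex_Icc _ _ : Convex ℝ (predInterval σ C)).norm_image_sub_le_of_norm_deriv_le
    (fun t _ => hl.differentiable_deriv z hz t) (fun t ht => hL z hz t ht) hb ha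

end Loss

end SGN
namespace SGN

/-! ### Minibatch quantities -/

section Batch

variable {d m H n : ℕ} {σ : ℝ → ℝ} {l : ℝ → Sample d → ℝ}

/-- The gradient `∇ φ(x; w)` in the parameters. -/
noncomputable def predGrad (σ : ℝ → ℝ) (z : Sample d) (w : Param d m H) : Param d m H :=
  ∇ (predictor σ z.1) w

/-- The derivative of the loss at the prediction. -/
noncomputable def lossDeriv (σ : ℝ → ℝ) (l : ℝ → Sample d → ℝ) (z : Sample d) (w : Param d m H) :
    ℝ :=
  deriv (fun t => l t z) (predictor σ z.1 w)

/-- The minibatch gradient as a vector of parameter space. -/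
noncomputable def gradVec (σ : ℝ → ℝ) (l : ℝ → Sample d → ℝ) (s : Fin n → Sample d)
    (I : Finset (Fin n)) (w : Param d m H) : Param d m H :=
  ∑ j ∈ I, lossDeriv σ l (s j) w • predGrad σ (s j) w

theorem toLp_batchGrad (s : Fin n → Sample d) (I : Finset (Fin n)) (w : Param d m H) :
    WithLp.toLp 2 (batchGrad σ l s I w) = gradVec σ l s I w := by
  ext i
  rw [gradVec]
  rw [← Finset.sum_coe_sort]
  simp only [batchGrad, Matrix.mulVec, dotProduct, WithLp.ofLp_sum, Finset.sum_apply,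
    WithLp.ofLp_smul, Pi.smul_apply, smul_eq_mul]
  exact Finset.sum_congr rfl fun j _ => mul_comm _ _

theorem form_batchGram (s : Fin n → Sample d) (I : Finset (Fin n)) (w u v : Param d m H) :
    form (batchGram σ s I w) u v
      = ∑ j ∈ I, inner ℝ (predGrad σ (s j) w) u * inner ℝ (predGrad σ (s j) w) v := by
  rw [form_apply, batchGram, ← Matrix.mulVec_mulVec, Matrix.dotProduct_mulVec,
    Matrix.vecMul_transpose, ← Finset.sum_coe_sort, dotProduct]
  refine Finset.sum_congr rfl fun j _ => ?_
  rw [← dotProduct_ofLp, ← dotProduct_ofLp]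
  rfl

/-- Uniform bounds, on a set `C` of parameters and a set `𝒵` of samples, for the predictions,
their gradients and the derivatives of the losses. -/
structure SmoothBounds (σ : ℝ → ℝ) (l : ℝ → Sample d → ℝ) (𝒵 : Set (Sample d))
    (C : Set (Param d m H)) (r Ll Ll2 Lφ Lg ν : ℝ) : Prop where
  r_nonneg : 0 ≤ r
  Ll_nonneg : 0 ≤ Ll
  Ll2_nonneg : 0 ≤ Ll2
  Lφ_nonneg : 0 ≤ Lφ
  Lg_nonneg : 0 ≤ Lg
  norm_sub_le : ∀ w ∈ C, ∀ w' ∈ C, ‖w - w'‖ ≤ r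
  norm_predGrad_le : ∀ z ∈ 𝒵, ∀ w ∈ C, ‖predGrad σ z w‖ ≤ Lφ
  norm_predGrad_sub_le : ∀ z ∈ 𝒵, ∀ w ∈ C, ∀ w' ∈ C, ‖predGrad σ z w - predGrad σ z w'‖ ≤ Lg * r
  abs_lossDeriv_le : ∀ z ∈ 𝒵, ∀ w ∈ C, |lossDeriv σ l z w| ≤ Ll
  taylor_left : ∀ z ∈ 𝒵, ∀ w ∈ C, ∀ w' ∈ C,
    |inner ℝ (predGrad σ z w) (w - w') - (predictor σ z.1 w - predictor σ z.1 w')| ≤ Lg * r ^ 2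
  taylor_right : ∀ z ∈ 𝒵, ∀ w ∈ C, ∀ w' ∈ C,
    |inner ℝ (predGrad σ z w') (w - w') - (predictor σ z.1 w - predictor σ z.1 w')| ≤ Lg * r ^ 2
  mul_sq_le : ∀ z ∈ 𝒵, ∀ w ∈ C, ∀ w' ∈ C,
    ν * (predictor σ z.1 w - predictor σ z.1 w') ^ 2
      ≤ (lossDeriv σ l z w - lossDeriv σ l z w') * (predictor σ z.1 w - predictor σ z.1 w')
  abs_lossDeriv_sub_le : ∀ z ∈ 𝒵, ∀ w ∈ C, ∀ w' ∈ C,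
    |lossDeriv σ l z w - lossDeriv σ l z w'| ≤ Ll2 * |predictor σ z.1 w - predictor σ z.1 w'|

theorem smoothBounds_of {σ₀ σ₁ σ₂ : ℝ} (hσ : IsActivation σ σ₀ σ₁ σ₂) {𝒵 : Set (Sample d)}
    (h𝒵 : ∀ z ∈ 𝒵, ‖z.1‖ ≤ 1) (hne : 𝒵.Nonempty) {ν : ℝ} (hl : IsLoss l 𝒵 ν)
    {C : Set (Param d m H)} (hC : IsCompact C) (hCne : C.Nonempty) (hconv : Convex ℝ C)
    {r Ll Ll2 Lφ Lg : ℝ} (hr : Metric.diam C ≤ r) (hLl : LossLip l 𝒵 σ C Ll)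
    (hLl2 : LossSmooth l 𝒵 σ C Ll2) (hLφ : PredLip σ C Lφ) (hLg : PredGradLip σ C Lg) :
    SmoothBounds σ l 𝒵 C r Ll Ll2 Lφ Lg ν := by
  obtain ⟨w₀, hw₀⟩ := hCne
  obtain ⟨z₀, hz₀⟩ := hne
  have hmem : ∀ z ∈ 𝒵, ∀ w ∈ C, predictor σ z.1 w ∈ predInterval σ C := fun z hz w hw =>
    predictor_mem_predInterval hσ.bound hC hw (h𝒵 z hz)
  have hLg0 : 0 ≤ Lg := (norm_nonneg _).trans (hLg w₀ hw₀ z₀.1 (h𝒵 z₀ hz₀))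
  have hsub : ∀ w ∈ C, ∀ w' ∈ C, ‖w - w'‖ ≤ r := fun w hw w' hw' => by
    rw [← dist_eq_norm]
    exact (Metric.dist_le_diam_of_mem hC.isBounded hw hw').trans hr
  have hsq : ∀ w ∈ C, ∀ w' ∈ C, Lg * ‖w - w'‖ ^ 2 ≤ Lg * r ^ 2 := fun w hw w' hw' => by
    have := hsub w hw w' hw'
    gcongr
  exact
  { r_nonneg := Metric.diam_nonneg.trans hr
    Ll_nonneg := (abs_nonneg _).trans (hLl z₀ hz₀ _ (hmem z₀ hz₀ w₀ hw₀))
    Ll2_nonneg := (abs_nonneg _).trans (hLl2 z₀ hz₀ _ (hmem z₀ hz₀ w₀ hw₀))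
    Lφ_nonneg := (norm_nonneg _).trans (hLφ w₀ hw₀ z₀.1 (h𝒵 z₀ hz₀))
    Lg_nonneg := hLg0
    norm_sub_le := hsub
    norm_predGrad_le := fun z hz w hw => hLφ w hw z.1 (h𝒵 z hz)
    norm_predGrad_sub_le := fun z hz w hw w' hw' =>
      (norm_gradient_sub_le hσ.contDiff hconv hLg (h𝒵 z hz) hw hw').trans
        (mul_le_mul_of_nonneg_left (hsub w hw w' hw') hLg0)
    abs_lossDeriv_le := fun z hz w hw => hLl z hz _ (hmem z hz w hw)
    taylor_left := fun z hz w hw w' hw' =>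
      (abs_inner_gradient_sub_le hσ.contDiff hconv hLg hLg0 (h𝒵 z hz) hw hw'
        (right_mem_segment ℝ w' w)).trans (hsq w hw w' hw')
    taylor_right := fun z hz w hw w' hw' =>
      (abs_inner_gradient_sub_le hσ.contDiff hconv hLg hLg0 (h𝒵 z hz) hw hw'
        (left_mem_segment ℝ w' w)).trans (hsq w hw w' hw')
    mul_sq_le := fun z hz w _ w' _ => hl.mul_sq_le hz _ _
    abs_lossDeriv_sub_le := fun z hz w hw w' hw' =>
      hl.abs_deriv_sub_le hLl2 hz (hmem z hz w hw) (hmem z hz w' hw') }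

end Batch

end SGN
namespace SGN

namespace SmoothBounds

variable {d m H n : ℕ} {σ : ℝ → ℝ} {l : ℝ → Sample d → ℝ}
  {𝒵 : Set (Sample d)} {C : Set (Param d m H)} {r Ll Ll2 Lφ Lg ν : ℝ}

theorem form_batchGram_le_sq (hb : SmoothBounds σ l 𝒵 C r Ll Ll2 Lφ Lg ν)
    {s : Fin n → Sample d} (hs : ∀ j, s j ∈ 𝒵) {I : Finset (Fin n)} {B : ℝ} (hB : (I.card : ℝ) ≤ B)
    {w w' : Param d m H} (hw : w ∈ C) (hw' : w' ∈ C) :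
    form (batchGram σ s I w) (w - w') (w - w')
      ≤ 2 * ∑ j ∈ I, (predictor σ (s j).1 w - predictor σ (s j).1 w') ^ 2
        + 2 * B * (Lg * r ^ 2) ^ 2 := by
  rw [form_batchGram]
  have h : ∀ j ∈ I, inner ℝ (predGrad σ (s j) w) (w - w') * inner ℝ (predGrad σ (s j) w) (w - w')
      ≤ 2 * (predictor σ (s j).1 w - predictor σ (s j).1 w') ^ 2 + 2 * (Lg * r ^ 2) ^ 2 := by
    intro j _
    have h1 := sq_le_sq' (abs_le.1 (hb.taylor_left (s j) (hs j) w hw w' hw')).1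
      (abs_le.1 (hb.taylor_left (s j) (hs j) w hw w' hw')).2
    set x : ℝ := inner ℝ (predGrad σ (s j) w) (w - w')
    set y := predictor σ (s j).1 w - predictor σ (s j).1 w'
    nlinarith [sq_nonneg (x - 2 * y)]
  refine (Finset.sum_le_sum h).trans ?_
  rw [Finset.sum_add_distrib, ← Finset.mul_sum, Finset.sum_const, nsmul_eq_mul]
  have := mul_le_mul_of_nonneg_right hB (by positivity : 0 ≤ 2 * (Lg * r ^ 2) ^ 2)
  linarith

theorem inner_gradVec_sub_ge (hb : SmoothBounds σ l 𝒵 C r Ll Ll2 Lφ Lg ν)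
    {s : Fin n → Sample d} (hs : ∀ j, s j ∈ 𝒵) {I : Finset (Fin n)} {B : ℝ} (hB : (I.card : ℝ) ≤ B)
    {w w' : Param d m H} (hw : w ∈ C) (hw' : w' ∈ C) :
    ν * ∑ j ∈ I, (predictor σ (s j).1 w - predictor σ (s j).1 w') ^ 2 - 2 * B * (Ll * (Lg * r ^ 2))
      ≤ inner ℝ (gradVec σ l s I w - gradVec σ l s I w') (w - w') := by
  rw [gradVec, gradVec, ← Finset.sum_sub_distrib, sum_inner]
  have h : ∀ j ∈ I, ν * (predictor σ (s j).1 w - predictor σ (s j).1 w') ^ 2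
        - 2 * (Ll * (Lg * r ^ 2))
      ≤ inner ℝ (lossDeriv σ l (s j) w • predGrad σ (s j) w
        - lossDeriv σ l (s j) w' • predGrad σ (s j) w') (w - w') := by
    intro j _
    have h1 := hb.taylor_left (s j) (hs j) w hw w' hw'
    have h2 := hb.taylor_right (s j) (hs j) w hw w' hw'
    have h3 := hb.abs_lossDeriv_le (s j) (hs j) w hw
    have h4 := hb.abs_lossDeriv_le (s j) (hs j) w' hw'
    have h5 := hb.mul_sq_le (s j) (hs j) w hw w' hw'
    rw [inner_sub_left, real_inner_smul_left, real_inner_smul_left]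
    set x : ℝ := inner ℝ (predGrad σ (s j) w) (w - w')
    set x' : ℝ := inner ℝ (predGrad σ (s j) w') (w - w')
    set y := predictor σ (s j).1 w - predictor σ (s j).1 w'
    set a := lossDeriv σ l (s j) w
    set a' := lossDeriv σ l (s j) w'
    have e1 : |a * (x - y)| ≤ Ll * (Lg * r ^ 2) := by
      rw [abs_mul]; exact mul_le_mul h3 h1 (abs_nonneg _) hb.Ll_nonneg
    have e2 : |a' * (x' - y)| ≤ Ll * (Lg * r ^ 2) := by
      rw [abs_mul]; exact mul_le_mul h4 h2 (abs_nonneg _) hb.Ll_nonneg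
    have e : a * x - a' * x' = (a - a') * y + a * (x - y) - a' * (x' - y) := by ring
    linarith [(abs_le.1 e1).1, (abs_le.1 e2).2]
  refine le_trans ?_ (Finset.sum_le_sum h)
  rw [Finset.sum_sub_distrib, ← Finset.mul_sum, Finset.sum_const, nsmul_eq_mul]
  have h0 : 0 ≤ 2 * (Ll * (Lg * r ^ 2)) := by
    have := hb.Ll_nonneg; have := hb.Lg_nonneg; positivity
  have := mul_le_mul_of_nonneg_right hB h0
  linarith

theorem norm_gradVec_sub_sq_le (hb : SmoothBounds σ l 𝒵 C r Ll Ll2 Lφ Lg ν)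
    {s : Fin n → Sample d} (hs : ∀ j, s j ∈ 𝒵) {I : Finset (Fin n)} {B : ℝ} (hB : (I.card : ℝ) ≤ B)
    {w w' : Param d m H} (hw : w ∈ C) (hw' : w' ∈ C) :
    ‖gradVec σ l s I w - gradVec σ l s I w'‖ ^ 2
      ≤ 2 * (Ll2 * Lφ) ^ 2 * B * ∑ j ∈ I, (predictor σ (s j).1 w - predictor σ (s j).1 w') ^ 2
        + 2 * (B * (Ll * (Lg * r))) ^ 2 := by
  have hLl := hb.Ll_nonneg
  have hLl2 := hb.Ll2_nonneg
  have hLφ := hb.Lφ_nonneg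
  have hLg := hb.Lg_nonneg
  have hr := hb.r_nonneg
  set δ : Fin n → ℝ := fun j => predictor σ (s j).1 w - predictor σ (s j).1 w'
  have h : ∀ j ∈ I, ‖lossDeriv σ l (s j) w • predGrad σ (s j) w
      - lossDeriv σ l (s j) w' • predGrad σ (s j) w'‖ ≤ Ll2 * Lφ * |δ j| + Ll * (Lg * r) := by
    intro j _
    have e : lossDeriv σ l (s j) w • predGrad σ (s j) w
        - lossDeriv σ l (s j) w' • predGrad σ (s j) w'
        = (lossDeriv σ l (s j) w - lossDeriv σ l (s j) w') • predGrad σ (s j) w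
          + lossDeriv σ l (s j) w' • (predGrad σ (s j) w - predGrad σ (s j) w') := by
      rw [sub_smul, smul_sub]; abel
    rw [e]
    refine (norm_add_le _ _).trans (add_le_add ?_ ?_)
    · rw [norm_smul, mul_right_comm]
      exact mul_le_mul (hb.abs_lossDeriv_sub_le (s j) (hs j) w hw w' hw')
        (hb.norm_predGrad_le (s j) (hs j) w hw) (norm_nonneg _) (by positivity)
    · rw [norm_smul]
      exact mul_le_mul (hb.abs_lossDeriv_le (s j) (hs j) w' hw')
        (hb.norm_predGrad_sub_le (s j) (hs j) w hw w' hw') (norm_nonneg _) hLl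
  have h1 : ‖gradVec σ l s I w - gradVec σ l s I w'‖
      ≤ Ll2 * Lφ * ∑ j ∈ I, |δ j| + B * (Ll * (Lg * r)) := by
    rw [gradVec, gradVec, ← Finset.sum_sub_distrib]
    refine (norm_sum_le_of_le _ h).trans ?_
    rw [Finset.sum_add_distrib, ← Finset.mul_sum, Finset.sum_const, nsmul_eq_mul]
    gcongr
  have h2 : (∑ j ∈ I, |δ j|) ^ 2 ≤ B * ∑ j ∈ I, δ j ^ 2 := by
    refine (sq_sum_le_card_mul_sum_sq).trans ?_
    simp only [sq_abs]
    exact mul_le_mul_of_nonneg_right hB (Finset.sum_nonneg fun _ _ => sq_nonneg _)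
  have h3 := pow_le_pow_left₀ (norm_nonneg _) h1 2
  refine h3.trans ?_
  have h4 := mul_le_mul_of_nonneg_left h2 (by positivity : 0 ≤ 2 * (Ll2 * Lφ) ^ 2)
  nlinarith [sq_nonneg (Ll2 * Lφ * ∑ j ∈ I, |δ j| - B * (Ll * (Lg * r)))]

/-- The preconditioned gradient step on one training set does not expand distances, up to an error
proportional to the curvature `Lg` of the predictor. -/
theorem gradient_step_bound (hb : SmoothBounds σ l 𝒵 C r Ll Ll2 Lφ Lg ν)
    {s : Fin n → Sample d} (hs : ∀ j, s j ∈ 𝒵) {I : Finset (Fin n)} {B : ℝ} (hB : (I.card : ℝ) ≤ B)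
    {w w' : Param d m H} (hw : w ∈ C) (hw' : w' ∈ C) {α η lam : ℝ} (hα : 0 ≤ α) (hη : 0 ≤ η)
    (hlam : 0 < lam) (hαη : 2 * α ≤ η * ν) (hstep : 2 * (Ll2 * Lφ) ^ 2 * B * η ≤ ν * lam) :
    α * form (batchGram σ s I w) (w - w') (w - w')
        - 2 * η * inner ℝ (gradVec σ l s I w - gradVec σ l s I w') (w - w')
        + η ^ 2 * ‖gradVec σ l s I w - gradVec σ l s I w'‖ ^ 2 / lam
      ≤ 2 * α * B * (Lg * r ^ 2) ^ 2 + 4 * η * B * (Ll * (Lg * r ^ 2))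
        + 2 * η ^ 2 * (B * (Ll * (Lg * r))) ^ 2 / lam := by
  have h1 := mul_le_mul_of_nonneg_left (hb.form_batchGram_le_sq hs hB hw hw') hα
  have h2 := mul_le_mul_of_nonneg_left (hb.inner_gradVec_sub_ge hs hB hw hw') hη
  have h3 := mul_le_mul_of_nonneg_left (hb.norm_gradVec_sub_sq_le hs hB hw hw')
    (by positivity : 0 ≤ η ^ 2 / lam)
  have hS : 0 ≤ ∑ j ∈ I, (predictor σ (s j).1 w - predictor σ (s j).1 w') ^ 2 :=
    Finset.sum_nonneg fun _ _ => sq_nonneg _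
  set S := ∑ j ∈ I, (predictor σ (s j).1 w - predictor σ (s j).1 w') ^ 2
  have h4 : η / lam * (2 * (Ll2 * Lφ) ^ 2 * B * η) * S ≤ η / lam * (ν * lam) * S := by gcongr
  have h5 : η / lam * (ν * lam) = η * ν := by field_simp
  rw [h5] at h4
  have h6 := mul_le_mul_of_nonneg_right hαη hS
  have e1 : η ^ 2 * ‖gradVec σ l s I w - gradVec σ l s I w'‖ ^ 2 / lam
      = η ^ 2 / lam * ‖gradVec σ l s I w - gradVec σ l s I w'‖ ^ 2 := by ring
  have e2 : η ^ 2 / lam * (2 * (Ll2 * Lφ) ^ 2 * B * S + 2 * (B * (Ll * (Lg * r))) ^ 2)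
      = η / lam * (2 * (Ll2 * Lφ) ^ 2 * B * η) * S
        + 2 * η ^ 2 * (B * (Ll * (Lg * r))) ^ 2 / lam := by ring
  rw [e1]
  rw [e2] at h3
  linarith

/-- Changing one sample changes the minibatch gradient only if the sample is in the minibatch. -/
theorem norm_gradVec_sub_gradVec_le (hb : SmoothBounds σ l 𝒵 C r Ll Ll2 Lφ Lg ν)
    {s s' : Fin n → Sample d} (hs : ∀ j, s j ∈ 𝒵) (hs' : ∀ j, s' j ∈ 𝒵) {j₀ : Fin n}
    (hj₀ : ∀ j, j ≠ j₀ → s j = s' j) (I : Finset (Fin n)) {w : Param d m H} (hw : w ∈ C) :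
    ‖gradVec σ l s I w - gradVec σ l s' I w‖ ≤ 2 * Ll * Lφ * (if j₀ ∈ I then 1 else 0) := by
  have hz : ∀ z ∈ 𝒵, ‖lossDeriv σ l z w • predGrad σ z w‖ ≤ Ll * Lφ := fun z hz => by
    rw [norm_smul]
    exact mul_le_mul (hb.abs_lossDeriv_le z hz w hw) (hb.norm_predGrad_le z hz w hw)
      (norm_nonneg _) hb.Ll_nonneg
  rw [gradVec, gradVec, ← Finset.sum_sub_distrib]
  split_ifs with h
  · rw [Finset.sum_eq_single_of_mem j₀ h fun j _ hj => by rw [hj₀ j hj, sub_self]]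
    refine (_root_.norm_sub_le _ _).trans ?_
    linarith [hz (s j₀) (hs j₀), hz (s' j₀) (hs' j₀)]
  · rw [Finset.sum_eq_zero fun j hj => by
      rw [hj₀ j (fun e => h (e ▸ hj)), sub_self]]
    simp

theorem abs_form_batchGram_sub_le (hb : SmoothBounds σ l 𝒵 C r Ll Ll2 Lφ Lg ν)
    {s s' : Fin n → Sample d} (hs : ∀ j, s j ∈ 𝒵) (hs' : ∀ j, s' j ∈ 𝒵) {j₀ : Fin n}
    (hj₀ : ∀ j, j ≠ j₀ → s j = s' j) {I : Finset (Fin n)} {B : ℝ} (hB : (I.card : ℝ) ≤ B)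
    {w w' : Param d m H} (hw : w ∈ C) (hw' : w' ∈ C) (u v : Param d m H) :
    |form (batchGram σ s I w) u v - form (batchGram σ s' I w') u v|
      ≤ (B * (2 * Lφ * (Lg * r)) + 2 * Lφ ^ 2 * (if j₀ ∈ I then 1 else 0)) * (‖u‖ * ‖v‖) := by
  have hLφ := hb.Lφ_nonneg
  have hLg := hb.Lg_nonneg
  have hr := hb.r_nonneg
  have hz : ∀ z ∈ 𝒵, ∀ w ∈ C, ∀ u : Param d m H, |inner ℝ (predGrad σ z w) u| ≤ Lφ * ‖u‖ :=
    fun z hz w hw u => (abs_real_inner_le_norm _ _).trans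
      (mul_le_mul_of_nonneg_right (hb.norm_predGrad_le z hz w hw) (norm_nonneg _))
  have hz2 : ∀ z ∈ 𝒵, ∀ u : Param d m H,
      |inner ℝ (predGrad σ z w) u - inner ℝ (predGrad σ z w') u| ≤ Lg * r * ‖u‖ :=
    fun z hz u => by
      rw [← inner_sub_left]
      exact (abs_real_inner_le_norm _ _).trans
        (mul_le_mul_of_nonneg_right (hb.norm_predGrad_sub_le z hz w hw w' hw') (norm_nonneg _))
  have hterm : ∀ j ∈ I, |inner ℝ (predGrad σ (s j) w) u * inner ℝ (predGrad σ (s j) w) v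
      - inner ℝ (predGrad σ (s' j) w') u * inner ℝ (predGrad σ (s' j) w') v|
      ≤ 2 * Lφ * (Lg * r) * (‖u‖ * ‖v‖) + if j₀ = j then 2 * Lφ ^ 2 * (‖u‖ * ‖v‖) else 0 := by
    intro j _
    split_ifs with h
    · have h1 : ∀ z ∈ 𝒵, ∀ w ∈ C,
          |inner ℝ (predGrad σ z w) u * inner ℝ (predGrad σ z w) v| ≤ Lφ ^ 2 * (‖u‖ * ‖v‖) := by
        intro z hz' w hw
        rw [abs_mul]
        refine (mul_le_mul (hz z hz' w hw u) (hz z hz' w hw v) (abs_nonneg _)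
          (by positivity)).trans (le_of_eq (by ring))
      have h2 : 0 ≤ 2 * Lφ * (Lg * r) * (‖u‖ * ‖v‖) := by positivity
      linarith [abs_sub (inner ℝ (predGrad σ (s j) w) u * inner ℝ (predGrad σ (s j) w) v)
        (inner ℝ (predGrad σ (s' j) w') u * inner ℝ (predGrad σ (s' j) w') v),
        h1 (s j) (hs j) w hw, h1 (s' j) (hs' j) w' hw']
    · rw [← hj₀ j (fun e => h e.symm), add_zero]
      have e : inner ℝ (predGrad σ (s j) w) u * inner ℝ (predGrad σ (s j) w) v
          - inner ℝ (predGrad σ (s j) w') u * inner ℝ (predGrad σ (s j) w') v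
          = inner ℝ (predGrad σ (s j) w) u
              * (inner ℝ (predGrad σ (s j) w) v - inner ℝ (predGrad σ (s j) w') v)
            + (inner ℝ (predGrad σ (s j) w) u - inner ℝ (predGrad σ (s j) w') u)
              * inner ℝ (predGrad σ (s j) w') v := by ring
      rw [e]
      refine (abs_add_le _ _).trans ?_
      rw [abs_mul, abs_mul]
      have h1 := mul_le_mul (hz (s j) (hs j) w hw u) (hz2 (s j) (hs j) v) (abs_nonneg _)
        (by positivity)
      have h2 := mul_le_mul (hz2 (s j) (hs j) u) (hz (s j) (hs j) w' hw' v) (abs_nonneg _)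
        (by positivity)
      refine (add_le_add h1 h2).trans (le_of_eq (by ring))
  rw [form_batchGram, form_batchGram, ← Finset.sum_sub_distrib]
  refine (Finset.abs_sum_le_sum_abs _ _).trans ((Finset.sum_le_sum hterm).trans ?_)
  rw [Finset.sum_add_distrib, Finset.sum_const, nsmul_eq_mul, Finset.sum_ite_eq]
  have h1 := mul_le_mul_of_nonneg_right hB (by positivity : 0 ≤ 2 * Lφ * (Lg * r) * (‖u‖ * ‖v‖))
  split_ifs <;> linarith

theorem form_batchGram_le (hb : SmoothBounds σ l 𝒵 C r Ll Ll2 Lφ Lg ν)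
    {s : Fin n → Sample d} (hs : ∀ j, s j ∈ 𝒵) {I : Finset (Fin n)} {B : ℝ} (hB : (I.card : ℝ) ≤ B)
    {w : Param d m H} (hw : w ∈ C) (v : Param d m H) :
    form (batchGram σ s I w) v v ≤ B * Lφ ^ 2 * ‖v‖ ^ 2 := by
  rw [form_batchGram]
  refine (Finset.sum_le_card_nsmul _ _ (Lφ ^ 2 * ‖v‖ ^ 2) fun j _ => ?_).trans ?_
  · rw [← sq, ← mul_pow, sq_le_sq, abs_of_nonneg (mul_nonneg hb.Lφ_nonneg (norm_nonneg _))]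
    exact (abs_real_inner_le_norm _ _).trans
      (mul_le_mul_of_nonneg_right (hb.norm_predGrad_le _ (hs j) w hw) (norm_nonneg _))
  · rw [nsmul_eq_mul, ← mul_assoc]
    gcongr

end SmoothBounds

end SGN
namespace SGN

/-! ### The two runs -/

section Run

variable {d m H n : ℕ} {σ : ℝ → ℝ} {l : ℝ → Sample d → ℝ} {C : Set (Param d m H)}
  {w₀ : Param d m H} {lam α η : ℝ}

/-- The preconditioner `H_{t-1}` used to measure distances at time `t`, with `H_{-1} = λ 𝟙`. -/
noncomputable def metric (σ : ℝ → ℝ) (l : ℝ → Sample d → ℝ) (C : Set (Param d m H))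
    (w₀ : Param d m H) (lam α η : ℝ) (s : Fin n → Sample d) (I : ℕ → Finset (Fin n)) (t : ℕ) :
    Matrix (ParamIdx d m H) (ParamIdx d m H) ℝ :=
  (state σ l C w₀ lam α η s I t).2

theorem form_metric_zero (s : Fin n → Sample d) (I : ℕ → Finset (Fin n)) (u v : Param d m H) :
    form (metric σ l C w₀ lam α η s I 0) u v = lam * inner ℝ u v := by
  rw [metric, state, form_smul_matrix, form_one]

theorem form_metric_succ (s : Fin n → Sample d) (I : ℕ → Finset (Fin n)) (t : ℕ)
    (u v : Param d m H) :
    form (metric σ l C w₀ lam α η s I (t + 1)) u v = form (metric σ l C w₀ lam α η s I t) u v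
      + α * form (batchGram σ s (I t) (iter σ l C w₀ lam α η s I t)) u v := by
  rw [← form_smul_matrix, ← form_add_matrix]
  rfl

theorem form_metric_comm (s : Fin n → Sample d) (I : ℕ → Finset (Fin n)) (t : ℕ)
    (u v : Param d m H) :
    form (metric σ l C w₀ lam α η s I t) u v = form (metric σ l C w₀ lam α η s I t) v u := by
  induction t with
  | zero => rw [form_metric_zero, form_metric_zero, real_inner_comm]
  | succ t ih =>
    rw [form_metric_succ, form_metric_succ, ih, form_batchGram, form_batchGram]
    simp only [mul_comm]

theorem le_form_metric (hα : 0 ≤ α) (s : Fin n → Sample d) (I : ℕ → Finset (Fin n)) (t : ℕ)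
    (v : Param d m H) : lam * ‖v‖ ^ 2 ≤ form (metric σ l C w₀ lam α η s I t) v v := by
  induction t with
  | zero => rw [form_metric_zero, real_inner_self_eq_norm_sq]
  | succ t ih =>
    rw [form_metric_succ, form_batchGram]
    have := mul_nonneg hα (Finset.sum_nonneg fun j (_ : j ∈ I t) =>
      mul_self_nonneg (inner ℝ (predGrad σ (s j) (iter σ l C w₀ lam α η s I t)) v : ℝ))
    linarith

theorem iter_mem (hC : IsCompact C) (hw₀ : w₀ ∈ C) (s : Fin n → Sample d)
    (I : ℕ → Finset (Fin n)) (t : ℕ) : iter σ l C w₀ lam α η s I t ∈ C := by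
  cases t with
  | zero => exact hw₀
  | succ t =>
    rw [iter_succ]
    exact (proj_spec hC ⟨w₀, hw₀⟩ _).1

theorem iter_variational (hα : 0 ≤ α) (hlam : 0 < lam) (hC : IsCompact C) (hconv : Convex ℝ C)
    (s : Fin n → Sample d) (I : ℕ → Finset (Fin n)) (t : ℕ) {v : Param d m H} (hv : v ∈ C) :
    0 ≤ form (metric σ l C w₀ lam α η s I (t + 1))
        (iter σ l C w₀ lam α η s I (t + 1) - iter σ l C w₀ lam α η s I t)
        (v - iter σ l C w₀ lam α η s I (t + 1))
      + η * inner ℝ (gradVec σ l s (I t) (iter σ l C w₀ lam α η s I t))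
        (v - iter σ l C w₀ lam α η s I (t + 1)) := by
  rw [← toLp_batchGrad]
  exact proj_step_variational (form_metric_comm s I (t + 1)) hlam (le_form_metric hα s I (t + 1))
    hC hconv _ _ η (iter_succ σ l C w₀ lam α η s I t) hv

/-- The number of times before `t` that the minibatch contains the index `j`. -/
def hits (j : Fin n) (I : ℕ → Finset (Fin n)) (t : ℕ) : ℝ :=
  ∑ i ∈ Finset.range t, if j ∈ I i then 1 else 0

theorem hits_succ (j : Fin n) (I : ℕ → Finset (Fin n)) (t : ℕ) :
    hits j I (t + 1) = hits j I t + if j ∈ I t then 1 else 0 :=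
  Finset.sum_range_succ _ _

theorem hits_nonneg (j : Fin n) (I : ℕ → Finset (Fin n)) (t : ℕ) : 0 ≤ hits j I t :=
  Finset.sum_nonneg fun _ _ => by split_ifs <;> norm_num

theorem hits_mono (j : Fin n) (I : ℕ → Finset (Fin n)) {t k : ℕ} (h : t ≤ k) :
    hits j I t ≤ hits j I k :=
  Finset.sum_le_sum_of_subset_of_nonneg (Finset.range_mono h)
    fun _ _ _ => by split_ifs <;> norm_num

variable {𝒵 : Set (Sample d)} {r Ll Ll2 Lφ Lg ν : ℝ}

theorem form_metric_le (hb : SmoothBounds σ l 𝒵 C r Ll Ll2 Lφ Lg ν) (hα : 0 ≤ α)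
    (hC : IsCompact C) (hw₀ : w₀ ∈ C) {s : Fin n → Sample d} (hs : ∀ j, s j ∈ 𝒵)
    {I : ℕ → Finset (Fin n)} {B : ℝ} {t : ℕ} (hB : ∀ i < t, ((I i).card : ℝ) ≤ B)
    (v : Param d m H) :
    form (metric σ l C w₀ lam α η s I t) v v ≤ (lam + t * (α * (B * Lφ ^ 2))) * ‖v‖ ^ 2 := by
  induction t with
  | zero => rw [form_metric_zero, real_inner_self_eq_norm_sq]; simp
  | succ t ih =>
    rw [form_metric_succ]
    have h1 := ih fun i hi => hB i (hi.trans t.lt_succ_self)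
    have h2 := mul_le_mul_of_nonneg_left
      (hb.form_batchGram_le hs (hB t t.lt_succ_self) (w := iter σ l C w₀ lam α η s I t)
        (iter_mem hC hw₀ s I t) v) hα
    refine (add_le_add h1 h2).trans (le_of_eq ?_)
    push_cast
    ring

theorem abs_form_metric_sub_le (hb : SmoothBounds σ l 𝒵 C r Ll Ll2 Lφ Lg ν) (hα : 0 ≤ α)
    (hC : IsCompact C) (hw₀ : w₀ ∈ C) {s s' : Fin n → Sample d} (hs : ∀ j, s j ∈ 𝒵)
    (hs' : ∀ j, s' j ∈ 𝒵) {j₀ : Fin n} (hj₀ : ∀ j, j ≠ j₀ → s j = s' j)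
    {I : ℕ → Finset (Fin n)} {B : ℝ} {t : ℕ} (hB : ∀ i < t, ((I i).card : ℝ) ≤ B)
    (u v : Param d m H) :
    |form (metric σ l C w₀ lam α η s I t) u v - form (metric σ l C w₀ lam α η s' I t) u v|
      ≤ α * (t * (B * (2 * Lφ * (Lg * r))) + 2 * Lφ ^ 2 * hits j₀ I t) * (‖u‖ * ‖v‖) := by
  induction t with
  | zero => rw [form_metric_zero, form_metric_zero]; simp [hits]
  | succ t ih =>
    have h1 := ih fun i hi => hB i (hi.trans t.lt_succ_self)
    have h2 := mul_le_mul_of_nonneg_left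
      (hb.abs_form_batchGram_sub_le hs hs' hj₀ (hB t t.lt_succ_self)
        (w := iter σ l C w₀ lam α η s I t) (w' := iter σ l C w₀ lam α η s' I t)
        (iter_mem hC hw₀ s I t) (iter_mem hC hw₀ s' I t) u v) hα
    rw [form_metric_succ, form_metric_succ, add_sub_add_comm, ← mul_sub, hits_succ]
    refine (abs_add_le _ _).trans ?_
    rw [abs_mul α, abs_of_nonneg hα]
    refine (add_le_add h1 h2).trans (le_of_eq ?_)
    push_cast
    ring

/-- Growth of the distance of the two runs in the metric of the first one, in the regime where the
steps on a common training set are stable. -/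
theorem sqrt_form_metric_iter_sub_le (hb : SmoothBounds σ l 𝒵 C r Ll Ll2 Lφ Lg ν) (hα : 0 ≤ α)
    (hη : 0 ≤ η) (hlam : 0 < lam)
    (hC : IsCompact C) (hconv : Convex ℝ C) (hw₀ : w₀ ∈ C) {s s' : Fin n → Sample d}
    (hs : ∀ j, s j ∈ 𝒵) (hs' : ∀ j, s' j ∈ 𝒵) {j₀ : Fin n} (hj₀ : ∀ j, j ≠ j₀ → s j = s' j)
    {I : ℕ → Finset (Fin n)} {B : ℝ} {k : ℕ} (hB : ∀ i < k, ((I i).card : ℝ) ≤ B)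
    (hB0 : 0 ≤ B) (hαη : 2 * α ≤ η * ν) (hstep : 2 * (Ll2 * Lφ) ^ 2 * B * η ≤ ν * lam)
    {c e : ℝ}
    (hc : c = 2 * α * B * (Lg * r ^ 2) ^ 2 + 4 * η * B * (Ll * (Lg * r ^ 2))
        + 2 * η ^ 2 * (B * (Ll * (Lg * r))) ^ 2 / lam)
    (he : e = α * (k * (B * (2 * Lφ * (Lg * r))) + 2 * Lφ ^ 2 * hits j₀ I k))
    {t : ℕ} (ht : t ≤ k) :
    √(form (metric σ l C w₀ lam α η s I t)
        (iter σ l C w₀ lam α η s I t - iter σ l C w₀ lam α η s' I t)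
        (iter σ l C w₀ lam α η s I t - iter σ l C w₀ lam α η s' I t))
      ≤ √(t * c) + (η * (2 * Ll * Lφ) * hits j₀ I t + t * (e * r)) / √lam := by
  have hLl := hb.Ll_nonneg
  have hLφ := hb.Lφ_nonneg
  have hLg := hb.Lg_nonneg
  have hr := hb.r_nonneg
  have hc0 : 0 ≤ c := by rw [hc]; positivity
  have he0 : 0 ≤ e := by
    have := hits_nonneg j₀ I k
    rw [he]; positivity
  induction t with
  | zero => simp [iter, state, hits]
  | succ t ih =>
    have htk : t < k := ht
    have ih := ih htk.le
    have hi := hits_nonneg j₀ I t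
    set M := metric σ l C w₀ lam α η s I (t + 1) with hM
    set M' := metric σ l C w₀ lam α η s' I (t + 1) with hM'
    set w := iter σ l C w₀ lam α η s I t with hw
    set w' := iter σ l C w₀ lam α η s' I t with hw'
    set v := iter σ l C w₀ lam α η s I (t + 1) with hv
    set v' := iter σ l C w₀ lam α η s' I (t + 1) with hv'
    have hwC : w ∈ C := iter_mem hC hw₀ s I t
    have hwC' : w' ∈ C := iter_mem hC hw₀ s' I t
    have hvC : v ∈ C := iter_mem hC hw₀ s I (t + 1)
    have hvC' : v' ∈ C := iter_mem hC hw₀ s' I (t + 1)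
    set h : ℝ := if j₀ ∈ I t then 1 else 0 with hh
    have hh0 : 0 ≤ h := by rw [hh]; split_ifs <;> norm_num
    set D := √(t * c) + (η * (2 * Ll * Lφ) * hits j₀ I t + t * (e * r)) / √lam with hD
    set p := gradVec σ l s (I t) w - gradVec σ l s (I t) w' with hp
    have hD0 : 0 ≤ D := by positivity
    have v1 := iter_variational (σ := σ) (l := l) (w₀ := w₀) (η := η) hα hlam hC hconv s I t hvC'
    have v2 := iter_variational (σ := σ) (l := l) (w₀ := w₀) (η := η) hα hlam hC hconv s' I t hvC
    rw [← hM, ← hw, ← hv] at v1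
    rw [← hM', ← hw', ← hv'] at v2
    have hB' : ∀ i < t + 1, ((I i).card : ℝ) ≤ B := fun i hi' => hB i (hi'.trans_le ht)
    have hE := abs_form_metric_sub_le (lam := lam) (η := η) hb hα hC hw₀ hs hs' hj₀ hB'
      (v' - w') (v - v')
    rw [← hM, ← hM'] at hE
    have hE2 : α * ((t + 1 : ℕ) * (B * (2 * Lφ * (Lg * r))) + 2 * Lφ ^ 2 * hits j₀ I (t + 1)) ≤ e := by
      have h1 := hits_mono j₀ I ht
      have h2 : ((t + 1 : ℕ) : ℝ) ≤ k := by exact_mod_cast ht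
      rw [he]
      gcongr
    have hE3 : |form M (v' - w') (v - v') - form M' (v' - w') (v - v')| ≤ e * r * ‖v - v'‖ := by
      refine (hE.trans (mul_le_mul_of_nonneg_right hE2 (by positivity))).trans ?_
      rw [mul_assoc]
      have := hb.norm_sub_le v' hvC' w' hwC'
      gcongr
    have hG : |inner ℝ (gradVec σ l s (I t) w' - gradVec σ l s' (I t) w') (v - v')|
        ≤ 2 * Ll * Lφ * h * ‖v - v'‖ :=
      (abs_real_inner_le_norm _ _).trans (mul_le_mul_of_nonneg_right
        (hb.norm_gradVec_sub_gradVec_le hs hs' hj₀ (I t) hwC') (norm_nonneg _))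
    have hmain : form M (v - v') (v - v') ≤ form M (w - w') (v - v') - η * inner ℝ p (v - v')
        + (η * (2 * Ll * Lφ) * h + e * r) * ‖v - v'‖ := by
      have x1 : form M (v - w) (v' - v) = - form M (v - w) (v - v') := by
        rw [← map_neg, neg_sub]
      have x2 : form M (v - v') (v - v') = form M (v - w) (v - v') - form M (v' - w') (v - v')
          + form M (w - w') (v - v') := by
        rw [← LinearMap.sub_apply, ← LinearMap.add_apply, ← map_sub, ← map_add]
        congr 2
        abel
      have x3 : (inner ℝ (gradVec σ l s (I t) w) (v' - v) : ℝ)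
          = - inner ℝ (gradVec σ l s (I t) w) (v - v') := by
        rw [← inner_neg_right, neg_sub]
      have x4 : (inner ℝ (gradVec σ l s (I t) w) (v - v') : ℝ)
          - inner ℝ (gradVec σ l s' (I t) w') (v - v') = inner ℝ p (v - v')
            + inner ℝ (gradVec σ l s (I t) w' - gradVec σ l s' (I t) w') (v - v') := by
        rw [← inner_sub_left, ← inner_add_left, hp]
        congr 1
        abel
      rw [x1, x3] at v1
      have y1 := (abs_le.1 hE3).1
      have y2 := mul_le_mul_of_nonneg_left (abs_le.1 hG).1 hη
      have y3 := congrArg (fun a => η * a) x4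
      rw [x2]
      linarith
    have hform : form M (w - w') (w - w') - 2 * η * inner ℝ p (w - w') + η ^ 2 * ‖p‖ ^ 2 / lam
        ≤ (√(D ^ 2 + c)) ^ 2 := by
      rw [Real.sq_sqrt (by positivity), hM, form_metric_succ, ← hw]
      have h1 := hb.gradient_step_bound hs (hB t htk) hwC hwC' hα hη hlam hαη hstep
      rw [← hc, ← hp] at h1
      have h2 := (Real.sqrt_le_left hD0).1 ih
      linarith
    have hstep' := sqrt_form_le_of_form_le (form_metric_comm s I (t + 1)) hlam
      (le_form_metric hα s I (t + 1)) (w - w') (v - v') p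
      (by positivity : 0 ≤ η * (2 * Ll * Lφ) * h + e * r) (Real.sqrt_nonneg (D ^ 2 + c)) hmain hform
    refine hstep'.trans ?_
    have hsq : √(D ^ 2 + c) ≤ √((t + 1 : ℕ) * c)
        + (η * (2 * Ll * Lφ) * hits j₀ I t + t * (e * r)) / √lam := by
      set A := (η * (2 * Ll * Lφ) * hits j₀ I t + t * (e * r)) / √lam with hA
      have hA0 : 0 ≤ A := by positivity
      apply Real.sqrt_le_iff.2 ⟨by positivity, ?_⟩
      have s1 : √(t * c) ^ 2 = t * c := Real.sq_sqrt (by positivity)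
      have s2 : √((t + 1 : ℕ) * c) ^ 2 = (t + 1 : ℕ) * c := Real.sq_sqrt (by positivity)
      have s3 : √(t * c) ≤ √((t + 1 : ℕ) * c) := by
        apply Real.sqrt_le_sqrt
        push_cast
        linarith
      have s4 := mul_le_mul_of_nonneg_right s3 hA0
      rw [hD]
      push_cast at s2 s3 s4 ⊢
      linarith
    refine (add_le_add_left hsq _).trans (le_of_eq ?_)
    rw [hits_succ, ← hh]
    push_cast
    ring

theorem deviation_le (hb : SmoothBounds σ l 𝒵 C r Ll Ll2 Lφ Lg ν) (hα : 0 ≤ α)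
    (hη : 0 ≤ η) (hlam : 0 < lam)
    (hC : IsCompact C) (hconv : Convex ℝ C) (hw₀ : w₀ ∈ C) {s s' : Fin n → Sample d}
    (hs : ∀ j, s j ∈ 𝒵) (hs' : ∀ j, s' j ∈ 𝒵) {j₀ : Fin n} (hj₀ : ∀ j, j ≠ j₀ → s j = s' j)
    {I : ℕ → Finset (Fin n)} {B : ℝ} {k : ℕ} (hk : 1 ≤ k) (hB : ∀ i < k, ((I i).card : ℝ) ≤ B)
    (hB0 : 0 ≤ B) (hαη : 2 * α ≤ η * ν) (hstep : 2 * (Ll2 * Lφ) ^ 2 * B * η ≤ ν * lam)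
    {c e : ℝ}
    (hc : c = 2 * α * B * (Lg * r ^ 2) ^ 2 + 4 * η * B * (Ll * (Lg * r ^ 2))
        + 2 * η ^ 2 * (B * (Ll * (Lg * r))) ^ 2 / lam)
    (he : e = α * (k * (B * (2 * Lφ * (Lg * r))) + 2 * Lφ ^ 2 * hits j₀ I k)) :
    deviation σ l C w₀ lam α η s s' I k
      ≤ √(k * c) + (η * (2 * Ll * Lφ) * hits j₀ I k + (k + 1) * (e * r)) / √lam := by
  have h1 := sqrt_form_metric_iter_sub_le (w₀ := w₀) hb hα hη hlam hC hconv hw₀ hs hs' hj₀ hB hB0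
    hαη hstep hc he le_rfl
  have h2 := abs_form_metric_sub_le (lam := lam) (η := η) hb hα hC hw₀ hs hs' hj₀ hB
    (iter σ l C w₀ lam α η s I k - iter σ l C w₀ lam α η s' I k)
    (iter σ l C w₀ lam α η s I k - iter σ l C w₀ lam α η s' I k)
  have h3 := le_form_metric (σ := σ) (l := l) (C := C) (w₀ := w₀) (lam := lam) (η := η) hα s I k
    (iter σ l C w₀ lam α η s I k - iter σ l C w₀ lam α η s' I k)
  have h4 := hb.norm_sub_le _ (iter_mem (σ := σ) (l := l) (lam := lam) (α := α) (η := η) hC hw₀ s I k)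
    _ (iter_mem (σ := σ) (l := l) (lam := lam) (α := α) (η := η) hC hw₀ s' I k)
  rw [← he] at h2
  have hr := hb.r_nonneg
  have hLφ := hb.Lφ_nonneg
  have hLg := hb.Lg_nonneg
  have he0 : 0 ≤ e := by
    have := hits_nonneg j₀ I k
    rw [he]; positivity
  have hsl : 0 < √lam := Real.sqrt_pos.2 hlam
  obtain ⟨k, rfl⟩ : ∃ k', k = k' + 1 := ⟨k - 1, by omega⟩
  rw [deviation, wnorm_eq_sqrt, form_smul_matrix, form_add_matrix, Nat.add_sub_cancel]
  change √(1 / 2 * (form (metric σ l C w₀ lam α η s I (k + 1)) _ _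
    + form (metric σ l C w₀ lam α η s' I (k + 1)) _ _)) ≤ _
  set Δ := iter σ l C w₀ lam α η s I (k + 1) - iter σ l C w₀ lam α η s' I (k + 1)
  set F := form (metric σ l C w₀ lam α η s I (k + 1)) Δ Δ
  set F' := form (metric σ l C w₀ lam α η s' I (k + 1)) Δ Δ
  have hF0 : 0 ≤ F := le_trans (by positivity) h3
  have hΔ : ‖Δ‖ * √lam ≤ √F := by
    apply Real.le_sqrt_of_sq_le
    rw [mul_pow, Real.sq_sqrt hlam.le, mul_comm]
    exact h3
  have key : √(1 / 2 * (F + F')) ≤ √F + e * r / √lam := by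
    apply Real.sqrt_le_iff.2 ⟨by positivity, ?_⟩
    have s1 : √F ^ 2 = F := Real.sq_sqrt hF0
    have s2 : e * (‖Δ‖ * ‖Δ‖) ≤ 2 * √F * (e * r / √lam) := by
      have y1 : ‖Δ‖ ≤ √F / √lam := (le_div_iff₀ hsl).2 hΔ
      have y2 : ‖Δ‖ * ‖Δ‖ ≤ √F / √lam * r := mul_le_mul y1 h4 (norm_nonneg _) (by positivity)
      have y3 := mul_le_mul_of_nonneg_left y2 he0
      have y4 : e * (√F / √lam * r) = √F * (e * r / √lam) := by ring
      have y5 : 0 ≤ √F * (e * r / √lam) := by positivity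
      linarith
    have s3 := (abs_le.1 h2).1
    have s4 : 0 ≤ e * (‖Δ‖ * ‖Δ‖) := by positivity
    nlinarith [sq_nonneg (e * r / √lam)]
  refine key.trans ((add_le_add_left h1 _).trans (le_of_eq ?_))
  ring

/-! ### Dependence of the runs on the data -/

theorem state_congr {s s' : Fin n → Sample d} {I I' : ℕ → Finset (Fin n)} {t : ℕ}
    (hI : ∀ i < t, I i = I' i) (hs : ∀ i < t, ∀ j ∈ I i, s j = s' j) :
    state σ l C w₀ lam α η s I t = state σ l C w₀ lam α η s' I' t := by
  induction t with
  | zero => rfl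
  | succ t ih =>
    have h := ih (fun i hi => hI i (hi.trans t.lt_succ_self))
      (fun i hi => hs i (hi.trans t.lt_succ_self))
    have hbatch : batch s (I t) = batch s' (I t) :=
      funext fun j => hs t t.lt_succ_self j j.2
    simp only [state, batchGrad, batchGram, h, hbatch]
    rw [hI t t.lt_succ_self]

theorem deviation_congr (s s' : Fin n → Sample d) {I I' : ℕ → Finset (Fin n)} {k : ℕ} (hk : 1 ≤ k)
    (hI : ∀ i < k, I i = I' i) :
    deviation σ l C w₀ lam α η s s' I k = deviation σ l C w₀ lam α η s s' I' k := by
  obtain ⟨k, rfl⟩ : ∃ k', k = k' + 1 := ⟨k - 1, by omega⟩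
  simp only [deviation, precond, iter, Nat.add_sub_cancel,
    state_congr (s := s) hI fun _ _ _ _ => rfl, state_congr (s := s') hI fun _ _ _ _ => rfl]

/-- A bound that uses only the diameter of `C` and that the runs agree until the first hit. -/
theorem deviation_le_hits_mul (hb : SmoothBounds σ l 𝒵 C r Ll Ll2 Lφ Lg ν) (hα : 0 ≤ α)
    (hlam : 0 < lam) (hC : IsCompact C) (hw₀ : w₀ ∈ C) {s s' : Fin n → Sample d}
    (hs : ∀ j, s j ∈ 𝒵) (hs' : ∀ j, s' j ∈ 𝒵) {j₀ : Fin n} (hj₀ : ∀ j, j ≠ j₀ → s j = s' j)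
    {I : ℕ → Finset (Fin n)} {B : ℝ} {k : ℕ} (hk : 1 ≤ k) (hB : ∀ i < k, ((I i).card : ℝ) ≤ B)
    (hαB : k * (α * B) ≤ 1) :
    deviation σ l C w₀ lam α η s s' I k ≤ hits j₀ I k * (r * (√lam + Lφ)) := by
  have hr := hb.r_nonneg
  have hLφ := hb.Lφ_nonneg
  by_cases hj : ∃ i < k, j₀ ∈ I i
  · obtain ⟨i, hik, hij⟩ := hj
    have h1 : 1 ≤ hits j₀ I k := by
      have h : (if j₀ ∈ I i then (1 : ℝ) else 0) ≤ hits j₀ I k :=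
        Finset.single_le_sum (f := fun i => if j₀ ∈ I i then (1 : ℝ) else 0)
          (fun _ _ => by split_ifs <;> norm_num) (Finset.mem_range.2 hik)
      rwa [if_pos hij] at h
    refine le_trans ?_ (le_mul_of_one_le_left (by positivity) h1)
    have h4 := hb.norm_sub_le _
      (iter_mem (σ := σ) (l := l) (lam := lam) (α := α) (η := η) hC hw₀ s I k)
      _ (iter_mem (σ := σ) (l := l) (lam := lam) (α := α) (η := η) hC hw₀ s' I k)
    have b1 := form_metric_le (lam := lam) (η := η) hb hα hC hw₀ hs hB
      (iter σ l C w₀ lam α η s I k - iter σ l C w₀ lam α η s' I k)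
    have b2 := form_metric_le (lam := lam) (η := η) hb hα hC hw₀ hs' hB
      (iter σ l C w₀ lam α η s I k - iter σ l C w₀ lam α η s' I k)
    have b3 : lam + k * (α * (B * Lφ ^ 2)) ≤ lam + Lφ ^ 2 := by
      have := mul_le_mul_of_nonneg_right hαB (sq_nonneg Lφ)
      linarith
    obtain ⟨k, rfl⟩ : ∃ k', k = k' + 1 := ⟨k - 1, by omega⟩
    rw [deviation, wnorm_eq_sqrt, form_smul_matrix, form_add_matrix, Nat.add_sub_cancel]
    change √(1 / 2 * (form (metric σ l C w₀ lam α η s I (k + 1)) _ _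
      + form (metric σ l C w₀ lam α η s' I (k + 1)) _ _)) ≤ _
    set Δ := iter σ l C w₀ lam α η s I (k + 1) - iter σ l C w₀ lam α η s' I (k + 1)
    apply Real.sqrt_le_iff.2 ⟨by positivity, ?_⟩
    have b4 := mul_le_mul_of_nonneg_right b3 (sq_nonneg ‖Δ‖)
    have b5 : (lam + Lφ ^ 2) * ‖Δ‖ ^ 2 ≤ (lam + Lφ ^ 2) * r ^ 2 := by gcongr
    have b6 : (lam + Lφ ^ 2) * r ^ 2 ≤ (r * (√lam + Lφ)) ^ 2 := by
      have e : (r * (√lam + Lφ)) ^ 2 = (√lam ^ 2 + Lφ ^ 2) * r ^ 2 + 2 * √lam * Lφ * r ^ 2 := by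
        ring
      rw [e, Real.sq_sqrt hlam.le]
      have : 0 ≤ 2 * √lam * Lφ * r ^ 2 := by positivity
      linarith
    linarith
  · push Not at hj
    have h := state_congr (σ := σ) (l := l) (C := C) (w₀ := w₀) (lam := lam) (α := α) (η := η)
      (s := s) (s' := s') (I := I) (I' := I) (t := k) (fun _ _ => rfl)
      (fun i hi j hj' => hj₀ j fun e => hj i hi (e ▸ hj'))
    have : deviation σ l C w₀ lam α η s s' I k = 0 := by
      rw [deviation, wnorm_eq_sqrt, iter, iter, h, sub_self, map_zero, Real.sqrt_zero]
    rw [this]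
    have := hits_nonneg j₀ I k
    positivity

end Run

end SGN
namespace SGN

/-! ### Expectations over the minibatches -/

section Sampling

variable {Ω : Type*} [MeasurableSpace Ω] {n B : ℕ} {P : Measure Ω} {I : ℕ → Ω → Finset (Fin n)}

theorem IsSubsampling.measure_mem (hI : IsSubsampling P B I) (t : ℕ)
    {S : Finset (Finset (Fin n))} (hS : ∀ M ∈ S, M.card = B) :
    P {ω | I t ω ∈ S} = S.card * ((n.choose B : ℕ) : ENNReal)⁻¹ := by
  have h : {ω | I t ω ∈ S} = ⋃ M ∈ S, {ω | I t ω = M} := by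
    ext ω
    simp
  rw [h, measure_biUnion_finset, Finset.sum_congr rfl fun M hM => hI.law t M (hS M hM),
    Finset.sum_const, nsmul_eq_mul]
  · intro M _ N _ hMN
    exact Set.disjoint_left.2 fun ω h1 h2 => hMN (h1.symm.trans h2)
  · exact fun M _ => hI.measurableSet t M

theorem IsSubsampling.measurableSet_mem (hI : IsSubsampling P B I) (t : ℕ)
    (S : Set (Finset (Fin n))) : MeasurableSet {ω | I t ω ∈ S} := by
  have h : {ω | I t ω ∈ S} = ⋃ M ∈ S, {ω | I t ω = M} := by
    ext ω
    simp
  rw [h]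
  exact MeasurableSet.biUnion S.to_countable fun M _ => hI.measurableSet t M

theorem IsSubsampling.ae_card_eq [IsProbabilityMeasure P] (hI : IsSubsampling P B I) (hB : B ≤ n)
    (t : ℕ) : ∀ᵐ ω ∂P, (I t ω).card = B := by
  have h : P {ω | I t ω ∈ Finset.powersetCard B Finset.univ} = 1 := by
    rw [hI.measure_mem t fun M hM => (Finset.mem_powersetCard.1 hM).2, Finset.card_powersetCard,
      Finset.card_univ, Fintype.card_fin]
    exact ENNReal.mul_inv_cancel (by exact_mod_cast (Nat.choose_pos hB).ne')
      (ENNReal.natCast_ne_top _)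
  have h2 := (prob_compl_eq_zero_iff (hI.measurableSet_mem t
    ↑(Finset.powersetCard B (Finset.univ : Finset (Fin n))))).2 h
  filter_upwards [measure_eq_zero_iff_ae_notMem.1 h2] with ω hω
  simpa using hω

theorem card_filter_mem_powersetCard_le (j : Fin n) :
    n * ((Finset.powersetCard B Finset.univ).filter fun M : Finset (Fin n) => j ∈ M).card
      ≤ B * n.choose B := by
  cases B with
  | zero => simp
  | succ b =>
    obtain ⟨n, rfl⟩ : ∃ n', n = n' + 1 := ⟨n - 1, by have := j.pos; omega⟩
    have h : ((Finset.powersetCard (b + 1) Finset.univ).filter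
        fun M : Finset (Fin (n + 1)) => j ∈ M).card ≤ n.choose b := by
      have e : (Finset.powersetCard b (Finset.univ.erase j)).card = n.choose b := by
        rw [Finset.card_powersetCard, Finset.card_erase_of_mem (Finset.mem_univ j)]
        simp
      rw [← e]
      refine Finset.card_le_card_of_injOn (fun M => M.erase j) ?_ ?_
      · intro M hM
        obtain ⟨hM1, hM2⟩ := Finset.mem_filter.1 (Finset.mem_coe.1 hM)
        refine Finset.mem_coe.2 (Finset.mem_powersetCard.2
          ⟨Finset.erase_subset_erase _ (Finset.subset_univ _), ?_⟩)
        rw [Finset.card_erase_of_mem hM2, (Finset.mem_powersetCard.1 hM1).2, Nat.add_sub_cancel]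
      · intro M hM N hN hMN
        have h : M.erase j = N.erase j := hMN
        rw [← Finset.insert_erase (Finset.mem_filter.1 (Finset.mem_coe.1 hM)).2, h,
          Finset.insert_erase (Finset.mem_filter.1 (Finset.mem_coe.1 hN)).2]
    calc (n + 1) * _ ≤ (n + 1) * n.choose b := Nat.mul_le_mul_left _ h
      _ = (b + 1) * (n + 1).choose (b + 1) := by rw [Nat.add_one_mul_choose_eq, mul_comm]

theorem IsSubsampling.measureReal_mem_le [IsProbabilityMeasure P] (hI : IsSubsampling P B I)
    (hB : B ≤ n) (t : ℕ) (j : Fin n) : P.real {ω | j ∈ I t ω} ≤ B / n := by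
  set S := (Finset.powersetCard B Finset.univ).filter fun M : Finset (Fin n) => j ∈ M with hS
  have h1 : P.real {ω | j ∈ I t ω} ≤ P.real {ω | I t ω ∈ S} := by
    refine ENNReal.toReal_mono (measure_ne_top _ _) (measure_mono_ae ?_)
    filter_upwards [hI.ae_card_eq hB t] with ω hω hj
    exact Finset.mem_filter.2 ⟨Finset.mem_powersetCard.2 ⟨Finset.subset_univ _, hω⟩, hj⟩
  refine h1.trans ?_
  rw [measureReal_def, hI.measure_mem t fun M hM =>
    (Finset.mem_powersetCard.1 (Finset.mem_filter.1 hM).1).2, ENNReal.toReal_mul,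
    ENNReal.toReal_inv, ENNReal.toReal_natCast, ENNReal.toReal_natCast, ← div_eq_mul_inv]
  have hn : (0 : ℝ) < n := by exact_mod_cast j.pos
  have hc : (0 : ℝ) < n.choose B := by exact_mod_cast Nat.choose_pos hB
  rw [div_le_div_iff₀ hc hn, mul_comm]
  exact_mod_cast card_filter_mem_powersetCard_le j

/-- A function of finitely many minibatches is integrable. -/
theorem IsSubsampling.integrable [IsFiniteMeasure P] (hI : IsSubsampling P B I) (k : ℕ)
    {f : (ℕ → Finset (Fin n)) → ℝ} (hf : ∀ J J', (∀ i < k, J i = J' i) → f J = f J') :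
    Integrable (fun ω => f fun t => I t ω) P := by
  let F : (Fin k → Finset (Fin n)) → ℝ := fun a => f fun t => if h : t < k then a ⟨t, h⟩ else ∅
  have hF : ∀ ω, f (fun t => I t ω) = F fun i => I i ω := fun ω => hf _ _ fun i hi => by
    simp [hi]
  simp only [hF]
  let _ : MeasurableSpace (Fin k → Finset (Fin n)) := ⊤
  have hX : Measurable fun ω => fun i : Fin k => I i ω := by
    refine measurable_to_countable' fun a => ?_
    have : (fun ω => fun i : Fin k => I i ω) ⁻¹' {a} = ⋂ i : Fin k, {ω | I i ω = a i} := by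
      ext ω
      simp [funext_iff]
    rw [this]
    exact MeasurableSet.iInter fun i => hI.measurableSet i (a i)
  have hFm : Measurable F := fun _ _ => trivial
  refine Integrable.of_bound (hFm.comp hX).aestronglyMeasurable (∑ a, ‖F a‖)
    (Filter.Eventually.of_forall fun ω => ?_)
  exact Finset.single_le_sum (f := fun a => ‖F a‖) (fun _ _ => norm_nonneg _) 
    (Finset.mem_univ fun i : Fin k => I i ω)

theorem IsSubsampling.integrable_hits [IsFiniteMeasure P] (hI : IsSubsampling P B I) (j : Fin n)
    (k : ℕ) : Integrable (fun ω => hits j (fun t => I t ω) k) P :=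
  hI.integrable k (f := fun J => hits j J k) fun J J' h =>
    Finset.sum_congr rfl fun i hi => by rw [h i (Finset.mem_range.1 hi)]

theorem IsSubsampling.integral_hits_le [IsProbabilityMeasure P] (hI : IsSubsampling P B I)
    (hB : B ≤ n) (j : Fin n) (k : ℕ) :
    ∫ ω, hits j (fun t => I t ω) k ∂P ≤ k * (B / n) := by
  have hm : ∀ t, MeasurableSet {ω | j ∈ I t ω} := fun t =>
    hI.measurableSet_mem t {M | j ∈ M}
  have hind : ∀ t ω, (if j ∈ I t ω then (1 : ℝ) else 0)
      = {ω | j ∈ I t ω}.indicator (fun _ => (1 : ℝ)) ω := fun t ω => by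
    simp [Set.indicator_apply]
  simp only [hits, hind]
  rw [integral_finsetSum _ fun t _ => (integrable_const _).indicator (hm t)]
  refine (Finset.sum_le_card_nsmul _ _ ((B : ℝ) / n) fun t _ => ?_).trans (by simp)
  rw [integral_indicator_const _ (hm t), smul_eq_mul, mul_one]
  exact hI.measureReal_mem_le hB t j

theorem IsSubsampling.integral_le_of_le_hits [IsProbabilityMeasure P] (hI : IsSubsampling P B I)
    (hB : B ≤ n) (j : Fin n) (k : ℕ) {f : Ω → ℝ} (hf : Integrable f P) {a b : ℝ} (hb : 0 ≤ b)
    (h : ∀ ω, (∀ t, (I t ω).card = B) → f ω ≤ a + b * hits j (fun t => I t ω) k) :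
    ∫ ω, f ω ∂P ≤ a + b * (k * (B / n)) := by
  have hN := hI.integrable_hits j k
  have h1 : ∫ ω, f ω ∂P ≤ ∫ ω, (a + b * hits j (fun t => I t ω) k) ∂P := by
    refine integral_mono_ae hf ((integrable_const a).add (hN.const_mul b)) ?_
    filter_upwards [ae_all_iff.2 fun t => hI.ae_card_eq hB t] with ω hω
    exact h ω hω
  refine h1.trans ?_
  rw [integral_add (integrable_const a) (hN.const_mul b), integral_const_mul]
  simp only [integral_const, probReal_univ, smul_eq_mul, one_mul]
  have := mul_le_mul_of_nonneg_left (hI.integral_hits_le hB j k) hb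
  linarith

end Sampling

/-! ### Collecting the constants -/

/-- The bound in the regime of stable steps, in terms of the quantities of the final estimate. -/
theorem stable_bound_le {r Ll Lφ Lg lam α η ξ B k n c : ℝ} (hr : 0 ≤ r) (hLl : 0 ≤ Ll)
    (hLφ : 0 ≤ Lφ) (hLg : 0 ≤ Lg) (hlam : 0 < lam) (hξ : 0 ≤ ξ) (hB : 1 ≤ B) (hk : 1 ≤ k)
    (hn : 0 < n) (hα : α = 1 / (B * k)) (hη : η = ξ * α) (hξ' : 2 * (B * Ll * Lg) * ξ ≤ k * lam)
    (hc : c = 2 * α * B * (Lg * r ^ 2) ^ 2 + 4 * η * B * (Ll * (Lg * r ^ 2))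
        + 2 * η ^ 2 * (B * (Ll * (Lg * r))) ^ 2 / lam) :
    √(k * c) + (k + 1) * (2 * Lφ * Lg * r ^ 2) / √lam
        + (η * (2 * Ll * Lφ) + (k + 1) * (r * (α * (2 * Lφ ^ 2)))) / √lam * (k * (B / n))
      ≤ (2 * r ^ 2 + (5 * Ll + 1) * r + 4 * r ^ 2 * Lφ + 4 * r * Lφ ^ 2 + 2 * Ll * Lφ)
        * (√(B * ξ * k * Lg) + √k * B * Lg + B * k / √lam * (Lg + 1 / n)
          + B * ξ / (n * √lam)) := by
  have hB0 : 0 < B := by linarith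
  have hk0 : 0 < k := by linarith
  have hsl : 0 < √lam := Real.sqrt_pos.2 hlam
  set T1 := √(B * ξ * k * Lg) with hT1
  set T2 := √k * B * Lg with hT2
  have hT10 : 0 ≤ T1 := Real.sqrt_nonneg _
  have hT20 : 0 ≤ T2 := by positivity
  have hT1s : T1 ^ 2 = B * ξ * k * Lg := Real.sq_sqrt (by positivity)
  have hT2s : T2 ^ 2 = k * B ^ 2 * Lg ^ 2 := by
    rw [hT2, mul_pow, mul_pow, Real.sq_sqrt hk0.le]
  have hkBk : k ≤ B * k := le_mul_of_one_le_left hk0.le hB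
  have hBk : 1 ≤ B * k := hk.trans hkBk
  have hBBk : 1 ≤ k * B ^ 2 := one_le_mul_of_one_le_of_one_le hk (one_le_pow₀ hB)
  have hkc : k * c ≤ 2 * Lg ^ 2 * r ^ 4 + 5 * (ξ * Ll * Lg * r ^ 2) := by
    have e : k * c = 2 * Lg ^ 2 * r ^ 4 + 4 * (ξ * Ll * Lg * r ^ 2)
        + (2 * (B * Ll * Lg) * ξ) / (k * lam) * (ξ * Ll * Lg * r ^ 2) / B := by
      rw [hc, hη, hα]
      field_simp
    have h1 : (2 * (B * Ll * Lg) * ξ) / (k * lam) ≤ 1 := (div_le_one (by positivity)).2 hξ'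
    have h2 : (2 * (B * Ll * Lg) * ξ) / (k * lam) * (ξ * Ll * Lg * r ^ 2) / B
        ≤ ξ * Ll * Lg * r ^ 2 := by
      have h3 : (2 * (B * Ll * Lg) * ξ) / (k * lam) * (ξ * Ll * Lg * r ^ 2)
          ≤ ξ * Ll * Lg * r ^ 2 := mul_le_of_le_one_left (by positivity) h1
      exact (div_le_self (by positivity) hB).trans h3
    linarith
  have p1 : √(k * c) ≤ 2 * r ^ 2 * T2 + (5 * Ll + 1) * r * T1 := by
    apply Real.sqrt_le_iff.2 ⟨by positivity, hkc.trans ?_⟩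
    have q1 : Lg ^ 2 * r ^ 4 ≤ r ^ 4 * T2 ^ 2 := by
      rw [hT2s]
      have := mul_le_mul_of_nonneg_right hBBk (by positivity : 0 ≤ Lg ^ 2 * r ^ 4)
      linarith
    have q2 : ξ * Ll * Lg * r ^ 2 ≤ Ll * r ^ 2 * T1 ^ 2 := by
      rw [hT1s]
      have := mul_le_mul_of_nonneg_right hBk (by positivity : 0 ≤ ξ * Ll * Lg * r ^ 2)
      linarith
    have q3 : 0 ≤ r ^ 4 * T2 ^ 2 := by positivity
    have q4 : 0 ≤ (2 * r ^ 2 * T2) * ((5 * Ll + 1) * r * T1) := by positivity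
    have q5 : 0 ≤ (25 * Ll ^ 2 + 5 * Ll + 1) * (r ^ 2 * T1 ^ 2) := by positivity
    linarith
  have p2 : (k + 1) * (2 * Lφ * Lg * r ^ 2) / √lam
      ≤ 4 * r ^ 2 * Lφ * (B * k / √lam * (Lg + 1 / n)) := by
    have e : 4 * r ^ 2 * Lφ * (B * k / √lam * (Lg + 1 / n))
        = (2 * (B * k) * (2 * Lφ * Lg * r ^ 2)) / √lam
          + 4 * r ^ 2 * Lφ * (B * k / √lam * (1 / n)) := by ring
    have h1 : 0 ≤ 4 * r ^ 2 * Lφ * (B * k / √lam * (1 / n)) := by positivity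
    have h2 : k + 1 ≤ 2 * (B * k) := by linarith
    have h3 : (k + 1) * (2 * Lφ * Lg * r ^ 2) / √lam
        ≤ (2 * (B * k) * (2 * Lφ * Lg * r ^ 2)) / √lam := by gcongr
    linarith
  have p3 : (η * (2 * Ll * Lφ) + (k + 1) * (r * (α * (2 * Lφ ^ 2)))) / √lam * (k * (B / n))
      ≤ 2 * Ll * Lφ * (B * ξ / (n * √lam)) + 4 * r * Lφ ^ 2 * (B * k / √lam * (Lg + 1 / n)) := by
    have e : (η * (2 * Ll * Lφ) + (k + 1) * (r * (α * (2 * Lφ ^ 2)))) / √lam * (k * (B / n))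
        = 2 * Ll * Lφ * (ξ / (n * √lam)) + 2 * r * Lφ ^ 2 * ((k + 1) / √lam * (1 / n)) := by
      rw [hη, hα]
      field_simp
    have h1 : ξ / (n * √lam) ≤ B * ξ / (n * √lam) := by
      gcongr
      exact le_mul_of_one_le_left hξ hB
    have h2 : (k + 1) / √lam * (1 / n) ≤ 2 * (B * k / √lam * (1 / n)) := by
      have h4 : k + 1 ≤ 2 * (B * k) := by linarith
      have h3 : (k + 1) / √lam * (1 / n) ≤ 2 * (B * k) / √lam * (1 / n) := by gcongr
      exact h3.trans (le_of_eq (by ring))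
    have h5 : 2 * r * Lφ ^ 2 * ((k + 1) / √lam * (1 / n))
        ≤ 2 * r * Lφ ^ 2 * (2 * (B * k / √lam * (1 / n))) := by gcongr
    have h6 : 2 * Ll * Lφ * (ξ / (n * √lam)) ≤ 2 * Ll * Lφ * (B * ξ / (n * √lam)) := by gcongr
    have h7 : 0 ≤ 4 * r * Lφ ^ 2 * (B * k / √lam * Lg) := by positivity
    rw [e]
    linarith
  set T3 := B * k / √lam * (Lg + 1 / n) with hT3
  set T4 := B * ξ / (n * √lam) with hT4
  have hT30 : 0 ≤ T3 := by positivity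
  have hT40 : 0 ≤ T4 := by positivity
  refine (add_le_add (add_le_add p1 p2) p3).trans ?_
  have z1 : 0 ≤ 2 * r ^ 2 * (T1 + T3 + T4) := by positivity
  have z2 : 0 ≤ (5 * Ll + 1) * r * (T2 + T3 + T4) := by positivity
  have z3 : 0 ≤ 4 * r ^ 2 * Lφ * (T1 + T2 + T4) := by positivity
  have z4 : 0 ≤ 4 * r * Lφ ^ 2 * (T1 + T2 + T4) := by positivity
  have z5 : 0 ≤ 2 * Ll * Lφ * (T1 + T2 + T3) := by positivity
  linarith

/-- The bound in the regime of large steps, in terms of the quantities of the final estimate. -/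
theorem large_step_bound_le {r Lφ Lg lam ξ B k n q : ℝ} (hr : 0 ≤ r)
    (hLφ : 0 ≤ Lφ) (hLg : 0 ≤ Lg) (hlam : 0 < lam) (hξ : 0 ≤ ξ) (hB : 0 ≤ B) (hk : 0 ≤ k)
    (hn : 0 < n) (hq : 0 ≤ q) (hkq : k * lam ≤ q * ξ) :
    r * (√lam + Lφ) * (k * (B / n))
      ≤ (r * (1 + Lφ) * q + r * Lφ)
        * (√(B * ξ * k * Lg) + √k * B * Lg + B * k / √lam * (Lg + 1 / n)
          + B * ξ / (n * √lam)) := by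
  have hsl : 0 < √lam := Real.sqrt_pos.2 hlam
  have hss : √lam * √lam = lam := Real.mul_self_sqrt hlam.le
  have h1 : √lam ≤ 1 + lam := by nlinarith [sq_nonneg (√lam - 1)]
  have e : r * (√lam + Lφ) * (k * (B / n))
      = r * B / (n * √lam) * (k * lam + Lφ * (k * √lam)) := by
    have aux : ∀ y : ℝ, 0 < y → r * (y + Lφ) * (k * (B / n))
        = r * B / (n * y) * (k * (y * y) + Lφ * (k * y)) := by
      intro y hy
      field_simp
    rw [aux _ hsl, hss]
  have h2 : k * lam + Lφ * (k * √lam) ≤ (1 + Lφ) * (q * ξ) + Lφ * k := by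
    have h3 := mul_le_mul_of_nonneg_left (mul_le_mul_of_nonneg_left h1 hk) hLφ
    have h4 := mul_le_mul_of_nonneg_left hkq (by linarith : 0 ≤ 1 + Lφ)
    linarith
  have h5 : r * B / (n * √lam) * (k * lam + Lφ * (k * √lam))
      ≤ r * B / (n * √lam) * ((1 + Lφ) * (q * ξ) + Lφ * k) := by gcongr
  have e2 : r * B / (n * √lam) * ((1 + Lφ) * (q * ξ) + Lφ * k)
      = r * (1 + Lφ) * q * (B * ξ / (n * √lam)) + r * Lφ * (B * k / √lam * (1 / n)) := by
    field_simp
  rw [e]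
  refine h5.trans ?_
  rw [e2]
  set T4 := B * ξ / (n * √lam)
  set T1 := √(B * ξ * k * Lg)
  set T2 := √k * B * Lg
  have hT1 : 0 ≤ T1 := Real.sqrt_nonneg _
  have hT2 : 0 ≤ T2 := by positivity
  have hT4 : 0 ≤ T4 := by positivity
  have e3 : B * k / √lam * (Lg + 1 / n) = B * k / √lam * Lg + B * k / √lam * (1 / n) := by ring
  rw [e3]
  have z1 : 0 ≤ r * (1 + Lφ) * q * (T1 + T2 + B * k / √lam * Lg + B * k / √lam * (1 / n)) := by
    positivity
  have z2 : 0 ≤ r * Lφ * (T1 + T2 + B * k / √lam * Lg + T4) := by positivity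
  linarith

end SGN

theorem corollary2 (r Ll Ll2 Lφ ν μ₀ : ℝ) (hν : 0 < ν) (hμ₀ : 0 < μ₀) :
    ∃ K : ℝ, 0 < K ∧
      ∀ (d m H n B k : ℕ), 1 ≤ H → 1 ≤ B → B ≤ n → 1 ≤ k →
      ∀ (σ : ℝ → ℝ) (σ₀ σ₁ σ₂ : ℝ), SGN.IsActivation σ σ₀ σ₁ σ₂ →
      ∀ (𝒳 : Set (EuclideanSpace ℝ (Fin d))) (𝒴 : Set ℝ),
        (∀ x ∈ 𝒳, ‖x‖ ≤ 1) → (∀ y ∈ 𝒴, |y| ≤ 1) →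
      ∀ l : ℝ → SGN.Sample d → ℝ, SGN.IsLoss l (𝒳 ×ˢ 𝒴) ν →
      ∀ C : Set (SGN.Param d m H), IsCompact C → Convex ℝ C → Metric.diam C ≤ r →
      ∀ w₀ ∈ C,
      SGN.LossLip l (𝒳 ×ˢ 𝒴) σ C Ll → SGN.LossSmooth l (𝒳 ×ˢ 𝒴) σ C Ll2 →
      SGN.PredLip σ C Lφ →
      ∀ Lg : ℝ, SGN.PredGradLip σ C Lg →
      ∀ s s' : Fin n → SGN.Sample d,
        (∀ j, s j ∈ 𝒳 ×ˢ 𝒴) → (∀ j, s' j ∈ 𝒳 ×ˢ 𝒴) → {j | s j ≠ s' j}.ncard = 1 →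
        (∀ w ∈ C, (SGN.jacobian σ s w * (SGN.jacobian σ s w)ᵀ
          - μ₀ ^ 2 • (1 : Matrix (Fin n) (Fin n) ℝ)).PosSemidef) →
      ∀ (Ω : Type*) [MeasurableSpace Ω] (P : Measure Ω) [IsProbabilityMeasure P]
        (I : ℕ → Ω → Finset (Fin n)), SGN.IsSubsampling P B I →
      ∀ lam : ℝ, 0 < lam →
      ∀ ε Λ M ξ α η : ℝ,
        ε = B * Ll * Lg → Λ = B * Lφ ^ 2 + ε →
        M = max (2 / ν) (8 * (Λ + ε) / (ν ^ 2 * μ₀ ^ 2)) →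
        M ≤ ξ → ξ ≤ k * lam / (2 * Λ) →
        α = 1 / (B * k) → η = ξ * α →
      Integrable (fun ω => SGN.deviation σ l C w₀ lam α η s s' (fun t => I t ω) k) P ∧
      ∫ ω, SGN.deviation σ l C w₀ lam α η s s' (fun t => I t ω) k ∂P ≤
        K * (√(B * ξ * k * Lg) + √(k : ℝ) * B * Lg
          + B * k / √lam * (Lg + 1 / n) + B * ξ / (n * √lam)) := by
  set K₁ := 2 * r ^ 2 + (5 * Ll + 1) * r + 4 * r ^ 2 * Lφ + 4 * r * Lφ ^ 2 + 2 * Ll * Lφ with hK₁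
  set q := 2 * (Ll2 * Lφ) ^ 2 / ν with hq
  set K₂ := r * (1 + Lφ) * q + r * Lφ with hK₂
  refine ⟨max 1 (max K₁ K₂), lt_max_of_lt_left one_pos, ?_⟩
  intro d m H n B k _ hB1 hBn hk σ σ₀ σ₁ σ₂ hσ 𝒳 𝒴 h𝒳 _ l hl C hC hconv hr w₀ hw₀ hLl hLl2 hLφ
    Lg hLg s s' hs hs' hss' _ Ω _ P _ I hI lam hlam ε Λ M ξ α η hε hΛ hM hMξ hξ hα hη
  obtain ⟨j₀, hj₀⟩ := Set.ncard_eq_one.1 hss'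
  have hj : ∀ j, j ≠ j₀ → s j = s' j := fun j hne => by
    by_contra hc
    have : j ∈ {j | s j ≠ s' j} := hc
    rw [hj₀] at this
    exact hne this
  have hb : SGN.SmoothBounds σ l (𝒳 ×ˢ 𝒴) C r Ll Ll2 Lφ Lg ν :=
    SGN.smoothBounds_of hσ (fun z hz => h𝒳 z.1 hz.1) ⟨s j₀, hs j₀⟩ hl hC ⟨w₀, hw₀⟩ hconv hr hLl hLl2
      hLφ hLg
  have hr0 := hb.r_nonneg
  have hLl0 := hb.Ll_nonneg
  have hLφ0 := hb.Lφ_nonneg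
  have hLg0 := hb.Lg_nonneg
  have hB1' : (1 : ℝ) ≤ B := by exact_mod_cast hB1
  have hk1' : (1 : ℝ) ≤ k := by exact_mod_cast hk
  have hB0 : (0 : ℝ) < B := by linarith
  have hk0 : (0 : ℝ) < k := by linarith
  have hn0 : (0 : ℝ) < n := by exact_mod_cast j₀.pos
  have hα0 : 0 < α := by rw [hα]; positivity
  have hξν : 2 / ν ≤ ξ := (le_max_left _ _).trans (hM ▸ hMξ)
  have hξ0 : 0 < ξ := lt_of_lt_of_le (by positivity) hξν
  have hη0 : 0 < η := by rw [hη]; positivity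
  have hΛ0 : 0 ≤ Λ := by rw [hΛ, hε]; positivity
  have hΛpos : 0 < Λ := by
    refine hΛ0.lt_of_ne fun h => ?_
    rw [← h, mul_zero, div_zero] at hξ
    linarith
  have hξΛ : 2 * (B * Ll * Lg) * ξ ≤ k * lam := by
    rw [le_div_iff₀ (by positivity)] at hξ
    have h1 : B * Ll * Lg ≤ Λ := by
      rw [hΛ, hε]
      have : 0 ≤ (B : ℝ) * Lφ ^ 2 := by positivity
      linarith
    have := mul_le_mul_of_nonneg_right h1 hξ0.le
    linarith
  have hint : Integrable (fun ω => SGN.deviation σ l C w₀ lam α η s s' (fun t => I t ω) k) P :=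
    hI.integrable k (f := fun J => SGN.deviation σ l C w₀ lam α η s s' J k) fun J J' h =>
      SGN.deviation_congr s s' hk h
  refine ⟨hint, ?_⟩
  set T := √(B * ξ * k * Lg) + √(k : ℝ) * B * Lg + B * k / √lam * (Lg + 1 / n)
    + B * ξ / (n * √lam) with hT
  have hT0 : 0 ≤ T := by positivity
  have hαB : k * (α * B) = 1 := by rw [hα]; field_simp
  by_cases hstep : 2 * (Ll2 * Lφ) ^ 2 * B * η ≤ ν * lam
  · set c := 2 * α * B * (Lg * r ^ 2) ^ 2 + 4 * η * B * (Ll * (Lg * r ^ 2))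
        + 2 * η ^ 2 * (B * (Ll * (Lg * r))) ^ 2 / lam with hc
    have hαη : 2 * α ≤ η * ν := by
      rw [div_le_iff₀ hν] at hξν
      rw [hη]
      have := mul_le_mul_of_nonneg_right hξν hα0.le
      linarith
    have h1 : ∫ ω, SGN.deviation σ l C w₀ lam α η s s' (fun t => I t ω) k ∂P
        ≤ (√(k * c) + (k + 1) * (2 * Lφ * Lg * r ^ 2) / √lam)
          + (η * (2 * Ll * Lφ) + (k + 1) * (r * (α * (2 * Lφ ^ 2)))) / √lam * (k * (B / n)) := by
      refine hI.integral_le_of_le_hits hBn j₀ k hint (by positivity) fun ω hω => ?_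
      refine (SGN.deviation_le hb hα0.le hη0.le hlam hC hconv hw₀ hs hs' hj hk (B := B)
        (fun i _ => by rw [hω i]) hB0.le hαη hstep hc rfl).trans (le_of_eq ?_)
      have e : α * (k * (B * (2 * Lφ * (Lg * r)))) = 2 * Lφ * (Lg * r) := by
        linear_combination (2 * Lφ * (Lg * r)) * hαB
      rw [mul_add α, e]
      ring
    have h2 := SGN.stable_bound_le hr0 hLl0 hLφ0 hLg0 hlam hξ0.le hB1' hk1' hn0 hα hη hξΛ hc
    exact (h1.trans h2).trans (mul_le_mul_of_nonneg_right
      ((le_max_left _ _).trans (le_max_right _ _)) hT0)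
  · have hkq : k * lam ≤ q * ξ := by
      push Not at hstep
      have h1 := mul_le_mul_of_nonneg_left hstep.le hk0.le
      have e : k * (2 * (Ll2 * Lφ) ^ 2 * B * η) = 2 * (Ll2 * Lφ) ^ 2 * ξ := by
        rw [hη]
        linear_combination (2 * (Ll2 * Lφ) ^ 2 * ξ) * hαB
      rw [hq, div_mul_eq_mul_div, le_div_iff₀ hν]
      linarith
    have h1 : ∫ ω, SGN.deviation σ l C w₀ lam α η s s' (fun t => I t ω) k ∂P
        ≤ 0 + r * (√lam + Lφ) * (k * (B / n)) := by
      refine hI.integral_le_of_le_hits hBn j₀ k hint (by positivity) fun ω hω => ?_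
      refine (SGN.deviation_le_hits_mul hb hα0.le hlam hC hw₀ hs hs' hj hk (B := B)
        (fun i _ => by rw [hω i]) hαB.le).trans (le_of_eq ?_)
      ring
    rw [zero_add] at h1
    have h2 := SGN.large_step_bound_le (n := n) hr0 hLφ0 hLg0 hlam hξ0.le hB0.le hk0.le hn0
      (by positivity : 0 ≤ q) hkq
    exact (h1.trans h2).trans (mul_le_mul_of_nonneg_right
      ((le_max_right _ _).trans (le_max_right _ _)) hT0)
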